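/- Consider a memoryless interference channel with three source-destination pairs, finite input alphabets $\mathcal X_k$, finite output alphabets $\mathcal Y_k$ and transition probability $P_{Y_1,Y_2,Y_3|X_1,X_2,X_3}$; let $P_{Y_k|X_1,X_2,X_3}$ be its marginals. Source $k$ sends an independent, uniformly distributed message of rate $R_k\ge 0$ to destination $k$, and the capacity region is the closed convex hull of the set of rate triples for which the error probability of suitable block codes goes to zero as the block length goes to infinity. Entropies and rates are in the same logarithmic unit. Let $(R_1,R_2,R_3)$ be in the capacity region. (a) (Any channel.) For some input distribution $P_{X_1,X_2,X_3,Q}=P_Q\prod_{k=1}^3P_{X_k|Q}$ with finite-valued $Q$ the following holds. Let $\tilde X_1,\tilde X_2,\tilde X_3$ be reference inputs, where $\tilde X_i\sim P_{X_i|Q}$ given $Q$, independently of $(X_1,X_2,X_3)$. Let $Y_{\backslash i}$ be distributed like $Y_i$ given $X_i$, with the intended input $X_i$ removed, i.e. given the inputs and $\tilde X_i=r$, the signal $Y_{\backslash i}$ has the law $P_{Y_i|X_1,X_2,X_3}$ evaluated with $X_i$ replaced by $r$. Let $\pi$ be any permutation of $\{1,2,3\}$ and $S_k=Y_{\backslash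 \pi(k)}$. Then $$R_1+R_2+R_3\le\sum_{k=1}^3\Big[H(Y_k|S_k,\tilde X_{\pi(k)},Q)-H(S_k|Y_k,X_1,X_2,X_3,\tilde X_{\pi(k)},Q)\Big]$$ for all joint conditional laws of $(Y_k,S_k)$ given $X_1,X_2,X_3,\tilde X_{\pi(k)}$, $k\in\{1,2,3\}$, that have the prescribed conditional marginals of $Y_k$ and of $S_k$; that is, the bound may be minimized over these joint laws. (b) (Channels whose intended signals can be removed outright.) Suppose that there are finite-valued signals $Y_{\backslash k}$, $k\in\{1,2,3\}$, whose conditional law given $X_1,X_2,X_3$ does not depend on $X_k$, such that, given $X_1,X_2,X_3$, the output $Y_k$ is distributed like $\phi_k(X_k,Y_{\backslash k})$, where $\phi_k(x_k,\cdot)$ is injective for each $x_k$ (for example, $Y_k$ is a sum of the intended signal and of $Y_{\backslash k}=$ interference plus noise). Then for some input distribution $P_{X_1,X_2,X_3,Q}=P_Q\prod_{k=1}^3P_{X_k|Q}$ with finite-valued $Q$, for every permutation $\pi$ of $\{1,2,3\}$ and with $S_k=Y_{\backslash\pi(k)}$, $$R_1+R_2+R_3\le\sum_{k=1}^3\Big[H(Y_k|S_k,Q)-H(S_k|Y_k,X_1,X_2,X_3,Q)\Big]$$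 for all joint conditional laws $P_{Y_k,S_k|X_1,X_2,X_3}$, $k\in\{1,2,3\}$, that have the prescribed conditional marginals of $Y_k$ and of $S_k$. -/

import Mathlib

namespace IFC

/-- Probability of the event `E` under the mass function `p` on a finite sample space. -/
noncomputable def prob {Ω : Type*} [Fintype Ω] (p : Ω → ℝ) (E : Ω → Prop) : ℝ :=
  open Classical in ∑ ω, if E ω then p ω else 0

/-- Conditional Shannon entropy
`H(A | B) = ∑ b, P(B = b) * ∑ a, - P(A = a | B = b) log P(A = a | B = b)` (in nats) of the random
variables `A`, `B` on the finite sample space `Ω` with mass function `p`. Values `b` of probability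
zero do not contribute. -/
noncomputable def condEntropy {Ω α β : Type*} [Fintype Ω] [Fintype α] [Fintype β]
    (p : Ω → ℝ) (A : Ω → α) (B : Ω → β) : ℝ :=
  ∑ b, prob p (fun ω => B ω = b) *
    ∑ a, Real.negMulLog (prob p (fun ω => A ω = a ∧ B ω = b) / prob p (fun ω => B ω = b))

/-- `J` is a joint mass function of a pair with marginals `p` and `q`. -/
structure IsCoupling {α β : Type*} [Fintype α] [Fintype β] (p : α → ℝ) (q : β → ℝ)
    (J : α × β → ℝ) : Prop where
  nonneg : ∀ z, 0 ≤ J z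
  fst : ∀ a, ∑ b, J (a, b) = p a
  snd : ∀ b, ∑ a, J (a, b) = q b

/-- A (discrete) memoryless interference channel with three source-destination pairs: `law x y` is
the transition probability `P(y₁, y₂, y₃ | x₁, x₂, x₃)`. -/
structure Channel (X Y : Fin 3 → Type*) [∀ k, Fintype (X k)] [∀ k, Fintype (Y k)] where
  law : (∀ k, X k) → (∀ k, Y k) → ℝ
  law_mem : ∀ x, law x ∈ stdSimplex ℝ (∀ k, Y k)

section

variable {X Y : Fin 3 → Type*} [∀ k, Fintype (X k)] [∀ k, Fintype (Y k)]

/-- The channel marginal `P(Y_k = y | x₁, x₂, x₃)`. -/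
noncomputable def Channel.out (W : Channel X Y) (k : Fin 3) (x : ∀ j, X j) (y : Y k) : ℝ :=
  prob (W.law x) (fun z => z k = y)

/-- A block code of length `n`: user `k` has `M k` messages, an encoder into codewords of length
`n`, and destination `k` has a decoder that sees the `k`-th output only. -/
structure Code (X Y : Fin 3 → Type*) (n : ℕ) where
  M : Fin 3 → ℕ
  enc : ∀ k, Fin (M k) → Fin n → X k
  dec : ∀ k, (Fin n → Y k) → Fin (M k)

/-- Probability that some destination decodes its message wrongly, for independent messages that
are uniformly distributed, over `n` uses of the memoryless channel. -/
noncomputable def Channel.errorProb (W : Channel X Y) {n : ℕ} (C : Code X Y n) : ℝ :=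
  (∑ w : ∀ k, Fin (C.M k),
    prob (fun y : Fin n → ∀ k, Y k => ∏ t, W.law (fun k => C.enc k (w k) t) (y t))
      (fun y => ∃ k, C.dec k (fun t => y t k) ≠ w k)) / ∏ k, (C.M k : ℝ)

/-- The rate triple `R` (in nats per channel use) is achievable: for every large block length there
are codes with at least `exp (n R_k)` messages for user `k`, with vanishing error probability. -/
def Channel.Achievable (W : Channel X Y) (R : Fin 3 → ℝ) : Prop :=
  (∀ k, 0 ≤ R k) ∧
    ∀ ε : ℝ, 0 < ε → ∃ N : ℕ, ∀ n : ℕ, N ≤ n → ∃ C : Code X Y n,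
      (∀ k, Real.exp (n * R k) ≤ C.M k) ∧ W.errorProb C ≤ ε

/-- The capacity region: the convex closure of the set of achievable rate triples. -/
def Channel.capacityRegion (W : Channel X Y) : Set (Fin 3 → ℝ) :=
  closure (convexHull ℝ {R | W.Achievable R})

/-- An input distribution `P_Q P_{X₁|Q} P_{X₂|Q} P_{X₃|Q}` with `Q` taking `m` values. -/
structure InputDist (X : Fin 3 → Type*) [∀ k, Fintype (X k)] (m : ℕ) where
  timeLaw : Fin m → ℝ
  timeLaw_mem : timeLaw ∈ stdSimplex ℝ (Fin m)
  inLaw : ∀ k, Fin m → X k → ℝ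
  inLaw_mem : ∀ k q, inLaw k q ∈ stdSimplex ℝ (X k)

/-- The joint mass function of `(Q, X₁, X₂, X₃)`. -/
def InputDist.joint {m : ℕ} (P : InputDist X m) (q : Fin m) (x : ∀ j, X j) : ℝ :=
  P.timeLaw q * ∏ j, P.inLaw j q (x j)

/-- The conditional law of the signal `Y_{\k}` given the inputs `x` and a reference symbol `r`: it
is the law of the channel output `k` when the intended input `x k` is removed and replaced by `r`;
so it is the law of `Y_k` given `X_k = r`, and it does not depend on `x k`. -/
noncomputable def Channel.removed (W : Channel X Y) (k : Fin 3) (r : X k) (x : ∀ j, X j) :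
    Y k → ℝ :=
  W.out k (Function.update x k r)

/-- Joint law of `(Q, X, X̃_i, Y_k, S_k)`, where `X̃_i` is a copy of `X_i` that is conditionally
independent of the inputs given `Q`, and `J` is the conditional law of `(Y_k, S_k)` given the
inputs and `X̃_i`. -/
def refJoint {m : ℕ} (P : InputDist X m) {k i : Fin 3} (J : (∀ j, X j) → X i → Y k × Y i → ℝ) :
    Fin m × (∀ j, X j) × X i × Y k × Y i → ℝ :=
  fun ⟨q, x, r, y, s⟩ => P.joint q x * P.inLaw i q r * J x r (y, s)

/-- `H(Y_k | S_k, X̃_i, Q) - H(S_k | Y_k, X₁, X₂, X₃, X̃_i, Q)`. -/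
noncomputable def refTerm {m : ℕ} (P : InputDist X m) {k i : Fin 3}
    (J : (∀ j, X j) → X i → Y k × Y i → ℝ) : ℝ :=
  condEntropy (refJoint P J) (fun ⟨_, _, _, y, _⟩ => y) (fun ⟨q, _, r, _, s⟩ => (s, r, q)) -
  condEntropy (refJoint P J) (fun ⟨_, _, _, _, s⟩ => s) (fun ⟨q, x, r, y, _⟩ => (y, x, r, q))

/-- Signals `Y_{\k}` obtained by an outright removal of the intended signals: `law k x` is the law of
`Y_{\k}` given the inputs, it does not depend on `x k`, and given `X_k = a` the channel output `Y_k`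
is an invertible function `combine k a` of `Y_{\k}`. (For example
`Y_k = h_k X_k + interference + noise` and `Y_{\k} = interference + noise`.) -/
structure Removal (W : Channel X Y) (V : Fin 3 → Type*) [∀ k, Fintype (V k)] where
  law : ∀ k, (∀ j, X j) → V k → ℝ
  law_mem : ∀ k x, law k x ∈ stdSimplex ℝ (V k)
  law_update : ∀ k x r, law k (Function.update x k r) = law k x
  combine : ∀ k, X k → V k → Y k
  combine_injective : ∀ k a, Function.Injective (combine k a)
  out_eq : ∀ k x y, W.out k x y = prob (law k x) (fun v => combine k (x k) v = y)

/-- Joint law of `(Q, X, Y_k, S_k)` when `J` is the conditional law of `(Y_k, S_k)` given the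
inputs. -/
def sideJoint {m : ℕ} (P : InputDist X m) {β S : Type*} (J : (∀ j, X j) → β × S → ℝ) :
    Fin m × (∀ j, X j) × β × S → ℝ :=
  fun ⟨q, x, y, s⟩ => P.joint q x * J x (y, s)

/-- `H(Y_k | S_k, Q) - H(S_k | Y_k, X₁, X₂, X₃, Q)`. -/
noncomputable def sideTerm {m : ℕ} (P : InputDist X m) {β S : Type*} [Fintype β] [Fintype S]
    (J : (∀ j, X j) → β × S → ℝ) : ℝ :=
  condEntropy (sideJoint P J) (fun ⟨_, _, y, _⟩ => y) (fun ⟨q, _, _, s⟩ => (s, q)) -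
  condEntropy (sideJoint P J) (fun ⟨_, _, _, s⟩ => s) (fun ⟨q, x, y, _⟩ => (y, x, q))

end

end IFC

/-! Converse for one code. Fix `k` and put `i = π k`. Besides the messages draw an independent
uniform copy of message `i`, and let the references of the signal S^n come from the codeword of that
copy. Given the copy, the law of S^n ignores message `i`, so this message may be taken equal to the
copy; then Y_i^n is an injective function of S^n, and H(S^n, copy) = H(W_i, Y_i^n)
(`entropy_signal_copy`). The output Y_k^n is independent of the copy (`entropy_output_copy`).
Expanding joint entropies, H(Y_k^n | S^n, copy) - H(S^n | Y_k^n, copy) = H(Y_k^n) - H(Y_i^n | W_i),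
whatever the coupling of output and signal. The left side is at most the sum over time of the
single-letter terms (`condEntropy_output_le`, `le_condEntropy_signal`). Summed over `k`, the right
side becomes Σ I(W_k; Y_k^n) because `π` is a permutation, and Fano's inequality bounds this from
below by the rates.

One input distribution for everything. The input laws of a code serve all permutations and couplings
at once, but only up to ε, and the alphabet of Q is then the block length, which grows as ε shrinks.
Infinitely many couplings have to be served, and the terms are not linear in them. They are convex,
however: with both marginals fixed, a term is a constant minus H(X | Y, S, ref) (`exists_term_eq`).
Helly's theorem therefore leaves a number of input laws bounded by a dimension, Hahn-Banach
separation turns their maximum into a mixture, and compactness lets ε tend to zero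
(`exists_finite_mixture`). Couplings for different permutations are put into one compact convex set,
`mixtures`, by scaling each with the weight of its permutation.

Both claims are instances of `RefRemoval`: the reference is the replaced input in the first and
trivial in the second. -/

namespace IFC

/-! ### Conditional entropy on finite spaces: chain rule, Gibbs' inequality, concavity, continuity.
-/

section Entropy

variable {Ω α β γ : Type*} [Fintype Ω] [Fintype α] [Fintype β] [Fintype γ]

theorem prob_nonneg {p : Ω → ℝ} (hp : ∀ ω, 0 ≤ p ω) (E : Ω → Prop) : 0 ≤ prob p E := by
  classical
  exact Finset.sum_nonneg fun ω _ => by split_ifs <;> simp [hp]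

theorem prob_mono {p : Ω → ℝ} (hp : ∀ ω, 0 ≤ p ω) {E F : Ω → Prop} (h : ∀ ω, E ω → F ω) :
    prob p E ≤ prob p F := by
  classical
  refine Finset.sum_le_sum fun ω _ => ?_
  by_cases hE : E ω
  · simp [hE, h ω hE]
  · simp only [hE, if_false]
    split_ifs <;> simp [hp]

theorem le_prob {p : Ω → ℝ} (hp : ∀ ω, 0 ≤ p ω) {E : Ω → Prop} {ω : Ω} (h : E ω) :
    p ω ≤ prob p E := by
  classical
  have := Finset.single_le_sum (f := fun ω => if E ω then p ω else 0)
    (fun i _ => by split_ifs <;> simp [hp]) (Finset.mem_univ ω)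
  simpa [h, prob] using this

/-- Change of variables: the mean of `g ∘ A` in terms of the law of `A`. -/
theorem sum_prob_mul (p : Ω → ℝ) (A : Ω → α) (g : α → ℝ) :
    ∑ a, prob p (fun ω => A ω = a) * g a = ∑ ω, p ω * g (A ω) := by
  classical
  simp only [prob, Finset.sum_mul]
  rw [Finset.sum_comm]
  refine Finset.sum_congr rfl fun ω _ => ?_
  simp [ite_mul]

theorem sum_prob_and_mul (p : Ω → ℝ) (A : Ω → α) (B : Ω → β) (g : α → β → ℝ) :
    ∑ b, ∑ a, prob p (fun ω => A ω = a ∧ B ω = b) * g a b = ∑ ω, p ω * g (A ω) (B ω) := by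
  have h := sum_prob_mul p (fun ω => (B ω, A ω)) (fun z => g z.2 z.1)
  rw [Fintype.sum_prod_type] at h
  simpa [Prod.ext_iff, and_comm] using h

theorem sum_prob_and (p : Ω → ℝ) (A : Ω → α) (E : Ω → Prop) :
    ∑ a, prob p (fun ω => A ω = a ∧ E ω) = prob p E := by
  classical
  simp only [prob]
  rw [Finset.sum_comm]
  refine Finset.sum_congr rfl fun ω _ => ?_
  by_cases h : E ω <;> simp [h]

theorem sum_prob_eq (p : Ω → ℝ) (A : Ω → α) : ∑ a, prob p (fun ω => A ω = a) = ∑ ω, p ω := by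
  simpa using sum_prob_mul p A (fun _ => 1)

theorem prob_and_le_right {p : Ω → ℝ} (hp : ∀ ω, 0 ≤ p ω) (E F : Ω → Prop) :
    prob p (fun ω => E ω ∧ F ω) ≤ prob p F := prob_mono hp fun _ h => h.2

theorem mul_negMulLog_div {u v : ℝ} (h : v = 0 → u = 0) :
    v * Real.negMulLog (u / v) = -(u * Real.log (u / v)) := by
  by_cases hv : v = 0
  · simp [hv, h hv]
  · rw [Real.negMulLog]; field_simp

theorem prob_and_eq_zero {p : Ω → ℝ} (hp : ∀ ω, 0 ≤ p ω) {E F : Ω → Prop} (h : prob p F = 0) :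
    prob p (fun ω => E ω ∧ F ω) = 0 :=
  le_antisymm (h ▸ prob_and_le_right hp E F) (prob_nonneg hp _)

/-- Writing the entropy as an expectation over the sample space makes it comparable with the cost of
any other kernel, and lets logarithms of products be split over time. -/
theorem condEntropy_eq_neg_sum {p : Ω → ℝ} (hp : ∀ ω, 0 ≤ p ω) (A : Ω → α) (B : Ω → β) :
    condEntropy p A B = -∑ ω, p ω * Real.log
      (prob p (fun ω' => A ω' = A ω ∧ B ω' = B ω) / prob p (fun ω' => B ω' = B ω)) := by
  rw [← sum_prob_and_mul p A B (fun a b => Real.log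
    (prob p (fun ω' => A ω' = a ∧ B ω' = b) / prob p (fun ω' => B ω' = b))),
    ← Finset.sum_neg_distrib]
  refine Finset.sum_congr rfl fun b _ => ?_
  rw [Finset.mul_sum, ← Finset.sum_neg_distrib]
  exact Finset.sum_congr rfl fun a _ => mul_negMulLog_div fun h => prob_and_eq_zero hp h

/-- Shannon entropy (in nats) of `A`; the mass function need not be normalised. -/
noncomputable def entropy (p : Ω → ℝ) (A : Ω → α) : ℝ :=
  ∑ a, Real.negMulLog (prob p (fun ω => A ω = a))

theorem entropy_comp_of_injective (p : Ω → ℝ) (A : Ω → α) {f : α → β} (hf : Function.Injective f) :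
    entropy p (fun ω => f (A ω)) = entropy p A := by
  symm
  refine Fintype.sum_of_injective f hf _ _ (fun b hb => ?_) fun a => by simp [hf.eq_iff]
  have : prob p (fun ω => f (A ω) = b) = 0 := by
    classical
    exact Finset.sum_eq_zero fun ω _ => if_neg fun h => hb ⟨_, h⟩
  rw [this, Real.negMulLog_zero]

/-- Chain rule. -/
theorem condEntropy_eq_sub {p : Ω → ℝ} (hp : ∀ ω, 0 ≤ p ω) (A : Ω → α) (B : Ω → β) :
    condEntropy p A B = entropy p (fun ω => (A ω, B ω)) - entropy p B := by
  have hAB : entropy p (fun ω => (A ω, B ω)) =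
      ∑ b, ∑ a, Real.negMulLog (prob p (fun ω => A ω = a ∧ B ω = b)) := by
    rw [entropy, Fintype.sum_prod_type_right]
    simp only [Prod.mk.injEq]
  rw [hAB, entropy, ← Finset.sum_sub_distrib]
  refine Finset.sum_congr rfl fun b _ => ?_
  set v := prob p (fun ω => B ω = b) with hv
  have h1 : Real.negMulLog v = ∑ a, -(prob p (fun ω => A ω = a ∧ B ω = b) * Real.log v) := by
    rw [Finset.sum_neg_distrib, ← Finset.sum_mul, sum_prob_and, Real.negMulLog]; ring
  rw [h1, ← Finset.sum_sub_distrib, Finset.mul_sum]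
  refine Finset.sum_congr rfl fun a _ => ?_
  have h0 : v = 0 → prob p (fun ω => A ω = a ∧ B ω = b) = 0 := fun h => prob_and_eq_zero hp h
  generalize prob p (fun ω => A ω = a ∧ B ω = b) = u at *
  rw [mul_negMulLog_div h0]
  by_cases hu : u = 0
  · simp [hu]
  · rw [Real.log_div hu (fun h => hu (h0 h)), Real.negMulLog]; ring

/-- The mass function of `B` when the sample space is a product of the range of `B` and a rest. -/
theorem prob_eq_sum_of_equiv (e : β × γ ≃ Ω) (p : Ω → ℝ) (B : Ω → β)
    (he : ∀ z, B (e z) = z.1) (b : β) : prob p (fun ω => B ω = b) = ∑ c, p (e (b, c)) := by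
  classical
  rw [prob, ← e.sum_comp, Fintype.sum_prod_type_right]
  simp [he]

theorem condEntropy_congr {Ω' : Type*} [Fintype Ω'] {p : Ω → ℝ} {p' : Ω' → ℝ}
    {A : Ω → α} {B : Ω → β} {A' : Ω' → α} {B' : Ω' → β}
    (h : ∀ a b, prob p (fun ω => A ω = a ∧ B ω = b) = prob p' (fun ω => A' ω = a ∧ B' ω = b)) :
    condEntropy p A B = condEntropy p' A' B' := by
  have hB : ∀ b, prob p (fun ω => B ω = b) = prob p' (fun ω => B' ω = b) := fun b => by
    rw [← sum_prob_and p A, ← sum_prob_and p' A']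
    exact Finset.sum_congr rfl fun a _ => h a b
  simp only [condEntropy, h, hB]

/-- Gibbs' inequality: coding `A` given `B` with a mismatched kernel `q` costs at least the
conditional entropy. -/
theorem condEntropy_le_neg_sum {p : Ω → ℝ} (hp : ∀ ω, 0 ≤ p ω) (A : Ω → α) (B : Ω → β)
    (q : α → β → ℝ) (hq : ∀ a b, 0 ≤ q a b) (hq1 : ∀ b, ∑ a, q a b ≤ 1)
    (hpos : ∀ ω, 0 < p ω → 0 < q (A ω) (B ω)) :
    condEntropy p A B ≤ -∑ ω, p ω * Real.log (q (A ω) (B ω)) := by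
  rw [condEntropy_eq_neg_sum hp, neg_le_neg_iff, ← sub_nonpos, ← Finset.sum_sub_distrib]
  set P : α → β → ℝ := fun a b => prob p (fun ω => A ω = a ∧ B ω = b) with hP
  set PB : β → ℝ := fun b => prob p (fun ω => B ω = b) with hPB
  have hP0 : ∀ a b, 0 ≤ P a b := fun a b => prob_nonneg hp _
  have hPB0 : ∀ b, 0 ≤ PB b := fun b => prob_nonneg hp _
  -- The inequality log t ≤ t - 1 at the ratio of the mismatched kernel to the true conditional law.
  have key : ∀ ω, p ω * Real.log (q (A ω) (B ω)) - p ω * Real.log (P (A ω) (B ω) / PB (B ω)) ≤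
      p ω * (q (A ω) (B ω) * PB (B ω) / P (A ω) (B ω) - 1) := by
    intro ω
    rcases (hp ω).eq_or_lt with h | h
    · simp [← h]
    · have h1 : 0 < P (A ω) (B ω) :=
        h.trans_le (le_prob (E := fun ω' => A ω' = A ω ∧ B ω' = B ω) hp ⟨rfl, rfl⟩)
      have h2 : 0 < PB (B ω) := h.trans_le (le_prob (E := fun ω' => B ω' = B ω) hp rfl)
      have h3 := hpos ω h
      rw [← mul_sub, ← Real.log_div h3.ne' (div_pos h1 h2).ne', div_div_eq_mul_div]
      refine mul_le_mul_of_nonneg_left ?_ h.le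
      have := Real.log_le_sub_one_of_pos (x := q (A ω) (B ω) * PB (B ω) / P (A ω) (B ω))
        (by positivity)
      exact this
  refine (Finset.sum_le_sum fun ω _ => key ω).trans ?_
  rw [← sum_prob_and_mul p A B (fun a b => q a b * PB b / P a b - 1)]
  refine Finset.sum_nonpos fun b _ => ?_
  calc ∑ a, P a b * (q a b * PB b / P a b - 1)
      ≤ ∑ a, (q a b * PB b - P a b) := by
        refine Finset.sum_le_sum fun a _ => ?_
        rcases (hP0 a b).eq_or_lt with h | h
        · rw [← h]; have := mul_nonneg (hq a b) (hPB0 b); simpa using this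
        · apply le_of_eq; field_simp
    _ = (∑ a, q a b - 1) * PB b := by
        rw [Finset.sum_sub_distrib, ← Finset.sum_mul, hP]
        simp only [sum_prob_and]
        rw [hPB]; ring
    _ ≤ 0 := mul_nonpos_of_nonpos_of_nonneg (sub_nonpos.2 (hq1 b)) (hPB0 b)

/-- Conditioning on more decreases entropy. -/
theorem condEntropy_le_of_comp {p : Ω → ℝ} (hp : ∀ ω, 0 ≤ p ω) (A : Ω → α) (B : Ω → β)
    (f : β → γ) : condEntropy p A B ≤ condEntropy p A (fun ω => f (B ω)) := by
  rw [condEntropy_eq_neg_sum hp A (fun ω => f (B ω))]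
  refine condEntropy_le_neg_sum hp A B (fun a b => prob p (fun ω' => A ω' = a ∧ f (B ω') = f b) /
    prob p (fun ω' => f (B ω') = f b)) (fun a b => ?_) (fun b => ?_) (fun ω h => ?_)
  · exact div_nonneg (prob_nonneg hp _) (prob_nonneg hp _)
  · rw [← Finset.sum_div, sum_prob_and]
    exact div_self_le_one _
  · exact div_pos
      (h.trans_le (le_prob (E := fun ω' => A ω' = A ω ∧ f (B ω') = f (B ω)) hp ⟨rfl, rfl⟩))
      (h.trans_le (le_prob (E := fun ω' => f (B ω') = f (B ω)) hp rfl))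

theorem prob_smul (c : ℝ) (p : Ω → ℝ) (E : Ω → Prop) : prob (c • p) E = c * prob p E := by
  classical
  simp [prob, Finset.mul_sum]

theorem prob_add (p q : Ω → ℝ) (E : Ω → Prop) : prob (p + q) E = prob p E + prob q E := by
  classical
  simp only [prob, ← Finset.sum_add_distrib]
  exact Finset.sum_congr rfl fun ω _ => by split_ifs <;> simp

theorem condEntropy_smul (c : ℝ) (p : Ω → ℝ) (A : Ω → α) (B : Ω → β) :
    condEntropy (c • p) A B = c * condEntropy p A B := by
  by_cases hc : c = 0
  · simp [condEntropy, hc, prob]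
  · simp only [condEntropy, prob_smul, mul_div_mul_left _ _ hc, mul_assoc, Finset.mul_sum]

/-- The perspective of a concave function is superadditive: Jensen's inequality with weights
proportional to `v₁` and `v₂`. -/
theorem mul_negMulLog_div_add_le {u₁ u₂ v₁ v₂ : ℝ} (hu₁ : 0 ≤ u₁) (hu₂ : 0 ≤ u₂) (hv₁ : 0 ≤ v₁)
    (hv₂ : 0 ≤ v₂) (h₁ : v₁ = 0 → u₁ = 0) (h₂ : v₂ = 0 → u₂ = 0) :
    v₁ * Real.negMulLog (u₁ / v₁) + v₂ * Real.negMulLog (u₂ / v₂) ≤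
      (v₁ + v₂) * Real.negMulLog ((u₁ + u₂) / (v₁ + v₂)) := by
  rcases hv₁.eq_or_lt with h | hv₁'
  · simp [← h, h₁ h.symm]
  rcases hv₂.eq_or_lt with h | hv₂'
  · simp [← h, h₂ h.symm]
  have hv : 0 < v₁ + v₂ := by positivity
  have := Real.concaveOn_negMulLog.2 (Set.mem_Ici.2 (div_nonneg hu₁ hv₁))
    (Set.mem_Ici.2 (div_nonneg hu₂ hv₂)) (div_nonneg hv₁ hv.le) (div_nonneg hv₂ hv.le)
    (by field_simp)
  simp only [smul_eq_mul] at this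
  have e : v₁ / (v₁ + v₂) * (u₁ / v₁) + v₂ / (v₁ + v₂) * (u₂ / v₂) = (u₁ + u₂) / (v₁ + v₂) := by
    field_simp
  rw [e] at this
  calc _ = (v₁ + v₂) * (v₁ / (v₁ + v₂) * Real.negMulLog (u₁ / v₁) +
        v₂ / (v₁ + v₂) * Real.negMulLog (u₂ / v₂)) := by field_simp
    _ ≤ _ := mul_le_mul_of_nonneg_left this hv.le

/-- Conditional entropy is superadditive (hence concave) in the mass function. -/
theorem condEntropy_add_le {p q : Ω → ℝ} (hp : ∀ ω, 0 ≤ p ω) (hq : ∀ ω, 0 ≤ q ω)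
    (A : Ω → α) (B : Ω → β) :
    condEntropy p A B + condEntropy q A B ≤ condEntropy (p + q) A B := by
  simp only [condEntropy, ← Finset.sum_add_distrib, Finset.mul_sum, prob_add]
  exact Finset.sum_le_sum fun b _ => Finset.sum_le_sum fun a _ =>
    mul_negMulLog_div_add_le (prob_nonneg hp _) (prob_nonneg hq _) (prob_nonneg hp _)
      (prob_nonneg hq _) (fun h => prob_and_eq_zero hp h) (fun h => prob_and_eq_zero hq h)

theorem continuous_prob (E : Ω → Prop) : Continuous fun p : Ω → ℝ => prob p E := by
  classical
  exact continuous_finsetSum _ fun ω _ => by split_ifs <;> fun_prop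

theorem continuousOn_condEntropy (A : Ω → α) (B : Ω → β) :
    ContinuousOn (fun p : Ω → ℝ => condEntropy p A B) {p | ∀ ω, 0 ≤ p ω} := by
  refine ContinuousOn.congr (f := fun p : Ω → ℝ =>
    entropy p (fun ω => (A ω, B ω)) - entropy p B) (Continuous.continuousOn ?_)
    fun p hp => condEntropy_eq_sub hp A B
  have := fun E : Ω → Prop => continuous_prob E
  unfold entropy
  fun_prop

end Entropy

/-! ### Minimax: from pointwise lower bounds to one finite mixture. -/

section Minimax

open Filter Topology Module

/-- Finite minimax: if the maximum of finitely many convex functions is everywhere at least `c`,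
so is some mixture of them. -/
theorem exists_weights_of_forall_exists {E ι : Type*} [AddCommGroup E] [Module ℝ E] [Fintype ι]
    [Nonempty ι] {Z : Set E} (hZ : Convex ℝ Z) (f : ι → E → ℝ)
    (hf : ∀ i, ConvexOn ℝ Z (f i)) {c : ℝ}
    (h : ∀ z ∈ Z, ∃ i, c ≤ f i z) :
    ∃ l ∈ stdSimplex ℝ ι, ∀ z ∈ Z, c ≤ ∑ i, l i * f i z := by
  classical
  rcases Z.eq_empty_or_nonempty with rfl | ⟨z0, hz0⟩
  · obtain ⟨i⟩ := ‹Nonempty ι›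
    exact ⟨Pi.single i 1, single_mem_stdSimplex ℝ i, by simp⟩
  -- The open orthant below `c` misses the upward closure `T` of the values of `f`; the coefficients
  -- of a separating functional, normalised, are the weights.
  let B : Set (ι → ℝ) := {v | ∀ i, v i < c}
  let T : Set (ι → ℝ) := {v | ∃ z ∈ Z, ∀ i, f i z ≤ v i}
  have hBc : Convex ℝ B := by
    have : B = Set.univ.pi fun _ => Set.Iio c := by ext v; simp [B]
    rw [this]
    exact convex_pi fun i _ => convex_Iio c
  have hBo : IsOpen B := by
    have : B = Set.univ.pi fun _ => Set.Iio c := by ext v; simp [B]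
    rw [this]
    exact isOpen_set_pi Set.finite_univ fun i _ => isOpen_Iio
  have hTc : Convex ℝ T := by
    rintro v ⟨z, hz, hv⟩ w ⟨y, hy, hw⟩ a b ha hb hab
    refine ⟨a • z + b • y, hZ hz hy ha hb hab, fun i => ((hf i).2 hz hy ha hb hab).trans ?_⟩
    simp only [smul_eq_mul, Pi.add_apply, Pi.smul_apply]
    exact add_le_add (mul_le_mul_of_nonneg_left (hv i) ha) (mul_le_mul_of_nonneg_left (hw i) hb)
  have hd : Disjoint B T := by
    rw [Set.disjoint_left]
    rintro v hv ⟨z, hz, hzv⟩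
    obtain ⟨i, hi⟩ := h z hz
    exact absurd (hi.trans (hzv i)) (not_le.2 (hv i))
  obtain ⟨g, u, hgB, hgT⟩ := geometric_hahn_banach_open hBc hBo hTc hd
  let l : ι → ℝ := fun i => g (Pi.single i 1)
  have hg : ∀ v, g v = ∑ i, l i * v i := fun v => by
    conv_lhs => rw [pi_eq_sum_univ' v]
    simp only [map_sum, map_smul, smul_eq_mul]
    exact Finset.sum_congr rfl fun i _ => by
      simp only [l, mul_comm]
  have hl : ∀ i, 0 ≤ l i := by
    intro i
    by_contra! hi
    have hb : ∀ t : ℝ, 0 ≤ t → g ((fun j => f j z0) + t • Pi.single i 1) ≥ u := fun t ht =>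
      hgT _ ⟨z0, hz0, fun j => by
        have : (0 : ℝ) ≤ (Pi.single i 1 : ι → ℝ) j := by
          rw [Pi.single_apply]; split_ifs <;> norm_num
        simpa using mul_nonneg ht this⟩
    set s := g (fun j => f j z0)
    -- `T` is closed upwards, so a negative coefficient would let `g` fall without bound on it; this
    -- step length already brings `g` below `u`.
    have h1 := hb ((|s - u| + 1) / -l i) (div_nonneg (by positivity) (by linarith))
    rw [map_add, map_smul, smul_eq_mul] at h1
    change s + _ * l i ≥ u at h1
    rw [div_mul_eq_mul_div, mul_div_assoc, div_neg, div_self hi.ne] at h1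
    have := le_abs_self (s - u)
    linarith
  have hl0 : 0 < ∑ i, l i := by
    rcases (Finset.sum_nonneg fun i _ => hl i).eq_or_lt with h0 | h0
    · have : ∀ i, l i = 0 := fun i => (Finset.sum_eq_zero_iff_of_nonneg fun i _ => hl i).1 h0.symm i
        (Finset.mem_univ i)
      have e : ∀ v, g v = 0 := fun v => by simp [hg, this]
      have h1 := hgB (fun _ => c - 1) (fun _ => by simp)
      have h2 := hgT (fun j => f j z0) ⟨z0, hz0, fun _ => le_rfl⟩
      rw [e] at h1 h2
      linarith
    · exact h0
  have hu : c * ∑ i, l i ≤ u := by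
    refine le_of_forall_pos_le_add fun ε hε => ?_
    -- At this constant vector of the orthant `g` equals `c * ∑ i, l i - ε`.
    have := hgB (fun _ => c - ε / ∑ i, l i) (fun _ => by simp; positivity)
    rw [hg, ← Finset.sum_mul, mul_sub, mul_div_cancel₀ _ hl0.ne'] at this
    linarith
  refine ⟨fun i => l i / ∑ j, l j, ⟨fun i => div_nonneg (hl i) hl0.le, ?_⟩, fun z hz => ?_⟩
  · rw [← Finset.sum_div, div_self hl0.ne']
  · have := hu.trans (hgT (fun i => f i z) ⟨z, hz, fun _ => le_rfl⟩)
    rw [hg] at this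
    simp only [div_mul_eq_mul_div]
    rw [← Finset.sum_div, le_div_iff₀ hl0]
    exact this

/-- A family of convex functions, continuously parametrised by a compact space, whose supremum is
everywhere at least `c` has a finite mixture that is everywhere at least `c`. -/
theorem exists_finite_mixture {E K : Type*} [NormedAddCommGroup E] [NormedSpace ℝ E]
    [FiniteDimensional ℝ E] [TopologicalSpace K] [CompactSpace K] [FirstCountableTopology K]
    [Nonempty K]
    {Z : Set E} (hZ : Convex ℝ Z) (hZc : IsCompact Z) (f : K → E → ℝ)
    (hf : ∀ p, ConvexOn ℝ Z (f p)) (hfc : ∀ p, ContinuousOn (f p) Z)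
    (hfp : ∀ z ∈ Z, Continuous fun p => f p z) {c : ℝ}
    (h : ∀ ε > 0, ∀ z ∈ Z, ∃ p, c - ε ≤ f p z) :
    ∃ (m : ℕ) (p : Fin m → K) (l : Fin m → ℝ), l ∈ stdSimplex ℝ (Fin m) ∧
      ∀ z ∈ Z, c ≤ ∑ i, l i * f (p i) z := by
  classical
  set d := finrank ℝ E + 1 with hd
  have : Nonempty (Fin d) := ⟨⟨0, by omega⟩⟩
  have step : ∀ ε > 0, ∃ y : (Fin d → K) × stdSimplex ℝ (Fin d),
      ∀ z ∈ Z, c - ε ≤ ∑ i, y.2.1 i * f (y.1 i) z := by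
    intro ε hε
    have hI : ∃ I : Finset K, I.card ≤ d ∧ ∀ z ∈ Z, ∃ p ∈ I, c - ε ≤ f p z := by
      by_contra! hcon
      -- If no family of at most `d` functions sufficed, every `d` of the compact convex sublevel
      -- sets would meet, hence all of them would; a common point contradicts `h` at `ε / 2`.
      obtain ⟨z, hz⟩ := Convex.helly_theorem_compact' (𝕜 := ℝ)
        (F := fun p : K => {z ∈ Z | f p z ≤ c - ε}) (fun p => (hf p).convex_le _)
        (fun p => by
          have := (hfc p).preimage_isClosed_of_isClosed hZc.isClosed (isClosed_Iic (a := c - ε))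
          exact hZc.of_isClosed_subset this fun z hz => hz.1)
        (fun I hI => by
          obtain ⟨z, hz, hzI⟩ := hcon I hI
          exact ⟨z, Set.mem_iInter₂.2 fun p hp => ⟨hz, (hzI p hp).le⟩⟩)
      rw [Set.mem_iInter] at hz
      obtain ⟨p0⟩ := ‹Nonempty K›
      obtain ⟨p, hp⟩ := h (ε / 2) (by positivity) z (hz p0).1
      have := (hz p).2
      linarith
    obtain ⟨I, hId, hI⟩ := hI
    -- Padding to exactly `d` members keeps all approximations in one compact space, whatever ε is.
    obtain ⟨q, hq⟩ : ∃ q : Fin d → K, ∀ p ∈ I, ∃ i, q i = p := by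
      let e := I.equivFin.symm
      obtain ⟨p0⟩ := ‹Nonempty K›
      refine ⟨fun i => if hi : i.1 < I.card then (e ⟨i.1, hi⟩ : K) else p0, fun p hp => ?_⟩
      have hlt := (I.equivFin ⟨p, hp⟩).2
      exact ⟨⟨(I.equivFin ⟨p, hp⟩).1, hlt.trans_le hId⟩, by simp [e]⟩
    obtain ⟨l, hl, hlz⟩ := exists_weights_of_forall_exists hZ (fun i => f (q i))
      (fun i => hf _) (c := c - ε) fun z hz => by
        obtain ⟨p, hp, hpz⟩ := hI z hz
        obtain ⟨i, rfl⟩ := hq p hp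
        exact ⟨i, hpz⟩
    exact ⟨(q, ⟨l, hl⟩), hlz⟩
  choose! y hy using step
  have : CompactSpace (stdSimplex ℝ (Fin d)) :=
    isCompact_iff_compactSpace.1 (isCompact_stdSimplex ℝ (Fin d))
  obtain ⟨a, φ, hφ, ha⟩ := CompactSpace.tendsto_subseq fun n : ℕ => y (1 / ((n : ℝ) + 1))
  refine ⟨d, a.1, a.2.1, a.2.2, fun z hz => ?_⟩
  have hlim : Tendsto (fun n : ℕ => c - 1 / ((φ n : ℝ) + 1)) atTop (𝓝 (c - 0)) :=
    tendsto_const_nhds.sub (tendsto_one_div_add_atTop_nhds_zero_nat.comp hφ.tendsto_atTop)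
  rw [sub_zero] at hlim
  have hcont : Continuous fun y : (Fin d → K) × stdSimplex ℝ (Fin d) =>
      ∑ i, y.2.1 i * f (y.1 i) z := by
    refine continuous_finsetSum _ fun i _ => Continuous.mul ?_ ?_
    · exact (continuous_apply i).comp (continuous_subtype_val.comp continuous_snd)
    · exact (hfp z hz).comp ((continuous_apply i).comp continuous_fst)
  exact le_of_tendsto_of_tendsto' hlim ((hcont.tendsto a).comp ha)
    fun n => hy _ (by positivity) z hz

end Minimax

/-! ### Single-letter terms: convexity and compactness in the couplings. -/

section SingleLetter

variable {X Y : Fin 3 → Type*} [∀ k, Fintype (X k)] [∀ k, Fintype (Y k)]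

theorem Channel.out_nonneg (W : Channel X Y) (k : Fin 3) (x : ∀ j, X j) (y : Y k) :
    0 ≤ W.out k x y := prob_nonneg (W.law_mem x).1 _

theorem Channel.sum_out (W : Channel X Y) (k : Fin 3) (x : ∀ j, X j) : ∑ y, W.out k x y = 1 := by
  simp only [Channel.out, sum_prob_eq, (W.law_mem x).2]

/-- Removal of the intended signals up to a reference `ref i (x i)` of the intended input: given the
reference `a`, the signal `law i a x` does not depend on `x i`, and at `a = ref i (x i)` it is an
invertible function of the channel output `i`. -/
structure RefRemoval (W : Channel X Y) (A V : Fin 3 → Type*) [∀ k, Fintype (V k)] where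
  ref : ∀ i, X i → A i
  law : ∀ i, A i → (∀ j, X j) → V i → ℝ
  law_mem : ∀ i a x, law i a x ∈ stdSimplex ℝ (V i)
  law_update : ∀ i a x r, law i a (Function.update x i r) = law i a x
  combine : ∀ i, X i → V i → Y i
  combine_injective : ∀ i a, Function.Injective (combine i a)
  out_eq : ∀ i x y, W.out i x y =
    prob (law i (ref i (x i)) x) (fun v => combine i (x i) v = y)

variable {W : Channel X Y} {A V : Fin 3 → Type*} [∀ k, Fintype (V k)]

namespace RefRemoval

/-- The law of the reference when the inputs have the laws `p`. -/
noncomputable def refLaw (D : RefRemoval W A V) (p : ∀ k, X k → ℝ) (i : Fin 3) (r : A i) : ℝ :=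
  prob (p i) (fun x => D.ref i x = r)

/-- Joint mass function of the inputs, an independent reference, and a pair with conditional mass
function `K`. -/
noncomputable def mass (D : RefRemoval W A V) (p : ∀ k, X k → ℝ) {k i : Fin 3}
    (K : (∀ j, X j) → A i → Y k × V i → ℝ) : (∀ j, X j) × A i × Y k × V i → ℝ :=
  fun z => (∏ j, p j (z.1 j)) * D.refLaw p i z.2.1 * K z.1 z.2.1 z.2.2

/-- `H(Y_k | S_k, ref) - H(S_k | Y_k, X, ref)`. -/
noncomputable def term [∀ k, Fintype (A k)] (D : RefRemoval W A V) (p : ∀ k, X k → ℝ) {k i : Fin 3}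
    (K : (∀ j, X j) → A i → Y k × V i → ℝ) : ℝ :=
  condEntropy (D.mass p K) (fun z => z.2.2.1) (fun z => (z.2.2.2, z.2.1)) -
  condEntropy (D.mass p K) (fun z => z.2.2.2) (fun z => (z.2.2.1, z.1, z.2.1))

/-- `K` is, for all inputs and references, `θ` times a coupling of the output and the signal. -/
structure IsScaledCoupling (D : RefRemoval W A V) {k i : Fin 3} (θ : ℝ)
    (K : (∀ j, X j) → A i → Y k × V i → ℝ) : Prop where
  nonneg : ∀ x r z, 0 ≤ K x r z
  fst : ∀ x r y, ∑ s, K x r (y, s) = θ * W.out k x y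
  snd : ∀ x r s, ∑ y, K x r (y, s) = θ * D.law i r x s

variable (D : RefRemoval W A V) {k i : Fin 3}

theorem refLaw_nonneg {p : ∀ k, X k → ℝ} (hp : ∀ k, p k ∈ stdSimplex ℝ (X k)) (r : A i) :
    0 ≤ D.refLaw p i r := prob_nonneg (hp i).1 _

theorem sum_refLaw [∀ k, Fintype (A k)] {p : ∀ k, X k → ℝ} (hp : ∀ k, p k ∈ stdSimplex ℝ (X k)) :
    ∑ r, D.refLaw p i r = 1 := by
  simp only [refLaw, sum_prob_eq, (hp i).2]

theorem prod_nonneg_of_mem {p : ∀ k, X k → ℝ} (hp : ∀ k, p k ∈ stdSimplex ℝ (X k))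
    (x : ∀ j, X j) : 0 ≤ ∏ j, p j (x j) := Finset.prod_nonneg fun j _ => (hp j).1 _

theorem sum_prod_of_mem {p : ∀ k, X k → ℝ} (hp : ∀ k, p k ∈ stdSimplex ℝ (X k)) :
    ∑ x : ∀ j, X j, ∏ j, p j (x j) = 1 := by
  classical
  rw [← Fintype.prod_sum]
  exact Finset.prod_eq_one fun j _ => (hp j).2

theorem mass_nonneg {p : ∀ k, X k → ℝ} (hp : ∀ k, p k ∈ stdSimplex ℝ (X k))
    {K : (∀ j, X j) → A i → Y k × V i → ℝ} (hK : ∀ x r z, 0 ≤ K x r z)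
    (z : (∀ j, X j) × A i × Y k × V i) : 0 ≤ D.mass p K z :=
  mul_nonneg (mul_nonneg (prod_nonneg_of_mem hp _) (D.refLaw_nonneg hp _)) (hK _ _ _)

theorem mass_add (p : ∀ k, X k → ℝ) (K L : (∀ j, X j) → A i → Y k × V i → ℝ) :
    D.mass p (K + L) = D.mass p K + D.mass p L := by
  ext z; simp [mass, mul_add]

theorem mass_smul (p : ∀ k, X k → ℝ) (c : ℝ) (K : (∀ j, X j) → A i → Y k × V i → ℝ) :
    D.mass p (c • K) = c • D.mass p K := by
  ext z; simp [mass]; ring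

theorem sum_negMulLog_mul {α : Type*} [Fintype α] (θ : ℝ) (c : α → ℝ) (hc : ∑ a, c a = 1) :
    ∑ a, Real.negMulLog (θ * c a) = Real.negMulLog θ + θ * ∑ a, Real.negMulLog (c a) := by
  simp only [Real.negMulLog_mul, Finset.sum_add_distrib, ← Finset.sum_mul, ← Finset.mul_sum, hc,
    one_mul]

/-- Up to a term that is linear in the scale, `term` is a negative conditional entropy. -/
theorem exists_term_eq [∀ k, Fintype (A k)] {p : ∀ k, X k → ℝ}
    (hp : ∀ k, p k ∈ stdSimplex ℝ (X k)) (k i : Fin 3) :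
    ∃ κ : ℝ, ∀ (θ : ℝ) (K : (∀ j, X j) → A i → Y k × V i → ℝ), D.IsScaledCoupling θ K →
      D.term p K = θ * κ -
        condEntropy (D.mass p K) (fun z => z.1) (fun z => (z.2.2.1, z.2.2.2, z.2.1)) := by
  let c : V i × A i → ℝ := fun b => ∑ x, (∏ j, p j (x j)) * D.refLaw p i b.2 * D.law i b.2 x b.1
  let d : Y k × (∀ j, X j) × A i → ℝ := fun b =>
    (∏ j, p j (b.2.1 j)) * D.refLaw p i b.2.2 * W.out k b.2.1 b.1
  refine ⟨∑ b, Real.negMulLog (d b) - ∑ b, Real.negMulLog (c b), fun θ K hK => ?_⟩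
  have hm := D.mass_nonneg hp hK.nonneg
  have h1 : entropy (D.mass p K) (fun z => (z.2.2.2, (z.2.2.1, z.1, z.2.1))) =
      entropy (D.mass p K) (fun z => (z.1, (z.2.2.1, z.2.2.2, z.2.1))) :=
    entropy_comp_of_injective (D.mass p K)
      (fun z => (z.1, (z.2.2.1, z.2.2.2, z.2.1)))
      (f := fun b : (∀ j, X j) × Y k × V i × A i => (b.2.2.1, (b.2.1, b.1, b.2.2.2)))
      (by rintro ⟨a, b, c, d⟩ ⟨a', b', c', d'⟩ h; simp_all)
  -- The laws of (S, ref) and of (Y, X, ref) involve only the prescribed marginals of `K`, so they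
  -- depend on `K` through `θ` alone. Their entropies both contain `Real.negMulLog θ`, which cancels
  -- in the difference.
  have hc : ∀ b, prob (D.mass p K) (fun z => (z.2.2.2, z.2.1) = b) = θ * c b := fun b => by
    rw [prob_eq_sum_of_equiv (γ := (∀ j, X j) × Y k)
      ⟨fun z => (z.2.1, z.1.2, z.2.2, z.1.1), fun z => ((z.2.2.2, z.2.1), (z.1, z.2.2.1)),
        fun _ => rfl, fun _ => rfl⟩ _ _ (fun _ => rfl), Fintype.sum_prod_type, Finset.mul_sum]
    refine Finset.sum_congr rfl fun x _ => ?_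
    simp only [mass, Equiv.coe_fn_mk, ← Finset.mul_sum, hK.snd]
    ring
  have hd : ∀ b, prob (D.mass p K) (fun z => (z.2.2.1, z.1, z.2.1) = b) = θ * d b := fun b => by
    rw [prob_eq_sum_of_equiv (γ := V i)
      ⟨fun z => (z.1.2.1, z.1.2.2, z.1.1, z.2), fun z => ((z.2.2.1, z.1, z.2.1), z.2.2.2),
        fun _ => rfl, fun _ => rfl⟩ _ _ (fun _ => rfl)]
    simp only [mass, Equiv.coe_fn_mk, ← Finset.mul_sum, hK.fst, d]
    ring
  have hbase : ∑ z : (∀ j, X j) × A i, (∏ j, p j (z.1 j)) * D.refLaw p i z.2 = 1 := by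
    rw [Fintype.sum_prod_type]
    simp only [← Finset.mul_sum, D.sum_refLaw hp, mul_one, sum_prod_of_mem hp]
  have hc1 : ∑ b, c b = 1 := by
    rw [← hbase, Fintype.sum_prod_type_right, Fintype.sum_prod_type_right]
    refine Finset.sum_congr rfl fun r _ => ?_
    simp only [c]
    rw [Finset.sum_comm]
    refine Finset.sum_congr rfl fun x _ => ?_
    rw [← Finset.mul_sum, (D.law_mem i r x).2, mul_one]
  have hd1 : ∑ b, d b = 1 := by
    rw [← hbase, Fintype.sum_prod_type_right]
    refine Finset.sum_congr rfl fun z _ => ?_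
    simp only [d]
    rw [← Finset.mul_sum, W.sum_out, mul_one]
  have e1 : entropy (D.mass p K) (fun z => (z.2.2.2, z.2.1)) =
      Real.negMulLog θ + θ * ∑ b, Real.negMulLog (c b) := by
    simp only [entropy, hc, sum_negMulLog_mul θ c hc1]
  have e2 : entropy (D.mass p K) (fun z => (z.2.2.1, z.1, z.2.1)) =
      Real.negMulLog θ + θ * ∑ b, Real.negMulLog (d b) := by
    simp only [entropy, hd, sum_negMulLog_mul θ d hd1]
  rw [term, condEntropy_eq_sub hm, condEntropy_eq_sub hm, condEntropy_eq_sub hm, h1, e1, e2]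
  ring

theorem term_smul [∀ k, Fintype (A k)] (p : ∀ k, X k → ℝ) (c : ℝ)
    (K : (∀ j, X j) → A i → Y k × V i → ℝ) :
    D.term p (c • K) = c * D.term p K := by
  simp only [term, mass_smul, condEntropy_smul, mul_sub]

variable {D}

theorem IsScaledCoupling.add_smul {θ θ' a b : ℝ} {K K' : (∀ j, X j) → A i → Y k × V i → ℝ}
    (h : D.IsScaledCoupling θ K) (h' : D.IsScaledCoupling θ' K') (ha : 0 ≤ a) (hb : 0 ≤ b) :
    D.IsScaledCoupling (a * θ + b * θ') (a • K + b • K') where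
  nonneg x r z := add_nonneg (mul_nonneg ha (h.nonneg _ _ _)) (mul_nonneg hb (h'.nonneg _ _ _))
  fst x r y := by
    simp only [Pi.add_apply, Pi.smul_apply, smul_eq_mul, Finset.sum_add_distrib, ← Finset.mul_sum,
      h.fst, h'.fst]
    ring
  snd x r y := by
    simp only [Pi.add_apply, Pi.smul_apply, smul_eq_mul, Finset.sum_add_distrib, ← Finset.mul_sum,
      h.snd, h'.snd]
    ring

/-- The part fixed by the marginals is linear in the scale, and the rest is minus a conditional
entropy, which is superadditive in the mass function. -/
theorem term_add_smul_le [∀ k, Fintype (A k)] {p : ∀ k, X k → ℝ}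
    (hp : ∀ k, p k ∈ stdSimplex ℝ (X k)) {θ θ' a b : ℝ}
    {K K' : (∀ j, X j) → A i → Y k × V i → ℝ} (h : D.IsScaledCoupling θ K)
    (h' : D.IsScaledCoupling θ' K') (ha : 0 ≤ a) (hb : 0 ≤ b) :
    D.term p (a • K + b • K') ≤ a * D.term p K + b * D.term p K' := by
  obtain ⟨κ, hκ⟩ := D.exists_term_eq hp k i
  rw [hκ _ _ h, hκ _ _ h', hκ _ _ (h.add_smul h' ha hb), mass_add, mass_smul, mass_smul]
  have := condEntropy_add_le (p := a • D.mass p K) (q := b • D.mass p K')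
    (fun z => mul_nonneg ha (D.mass_nonneg hp h.nonneg z))
    (fun z => mul_nonneg hb (D.mass_nonneg hp h'.nonneg z)) (fun z => z.1)
    (fun z => (z.2.2.1, z.2.2.2, z.2.1))
  rw [condEntropy_smul, condEntropy_smul] at this
  linarith

variable (D)

theorem continuous_mass_left (K : (∀ j, X j) → A i → Y k × V i → ℝ) :
    Continuous fun p : ∀ k, X k → ℝ => D.mass p K := by
  unfold mass refLaw
  refine continuous_pi fun z => ?_
  have h1 : Continuous fun p : ∀ k, X k → ℝ => prob (p i) (fun x => D.ref i x = z.2.1) :=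
    (continuous_prob _).comp (continuous_apply i)
  fun_prop

theorem continuous_mass_right (p : ∀ k, X k → ℝ) :
    Continuous fun K : (∀ j, X j) → A i → Y k × V i → ℝ => D.mass p K := by
  unfold mass
  fun_prop

/-- Triples of input laws. -/
abbrev InputLaws (X : Fin 3 → Type*) [∀ k, Fintype (X k)] :=
  {p : ∀ k, X k → ℝ // ∀ k, p k ∈ stdSimplex ℝ (X k)}

instance : CompactSpace (InputLaws X) := by
  have : IsCompact (Set.univ.pi fun k => stdSimplex ℝ (X k)) :=
    isCompact_univ_pi fun k => isCompact_stdSimplex ℝ (X k)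
  rw [show (Set.univ.pi fun k => stdSimplex ℝ (X k)) =
    {p | ∀ k, p k ∈ stdSimplex ℝ (X k)} by ext; simp] at this
  exact isCompact_iff_compactSpace.1 this

theorem continuous_term_left [∀ k, Fintype (A k)] {K : (∀ j, X j) → A i → Y k × V i → ℝ}
    (hK : ∀ x r z, 0 ≤ K x r z) :
    Continuous fun p : InputLaws X => D.term p.1 K := by
  have h : Continuous fun p : InputLaws X => D.mass p.1 K :=
    (D.continuous_mass_left K).comp continuous_subtype_val
  exact ((continuousOn_condEntropy _ _).comp_continuous h fun p => D.mass_nonneg p.2 hK).sub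
    ((continuousOn_condEntropy _ _).comp_continuous h fun p => D.mass_nonneg p.2 hK)

theorem continuousOn_term_right [∀ k, Fintype (A k)] {p : ∀ k, X k → ℝ}
    (hp : ∀ k, p k ∈ stdSimplex ℝ (X k)) :
    ContinuousOn (fun K : (∀ j, X j) → A i → Y k × V i → ℝ => D.term p K)
      {K | ∀ x r z, 0 ≤ K x r z} :=
  ((continuousOn_condEntropy _ _).comp (D.continuous_mass_right p).continuousOn
    fun _ hK => D.mass_nonneg hp hK).sub
  ((continuousOn_condEntropy _ _).comp (D.continuous_mass_right p).continuousOn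
    fun _ hK => D.mass_nonneg hp hK)

/-- The space of weighted families of kernels indexed by permutations and destinations. -/
abbrev KernelSpace (X Y A V : Fin 3 → Type*) :=
  (Equiv.Perm (Fin 3) → ℝ) × (∀ (π : Equiv.Perm (Fin 3)) (k : Fin 3),
    (∀ j, X j) → A (π k) → Y k × V (π k) → ℝ)

/-- The mixtures of couplings over permutations, the weight of each permutation being absorbed in
its kernels. -/
def mixtures : Set (KernelSpace X Y A V) :=
  {z | z.1 ∈ stdSimplex ℝ (Equiv.Perm (Fin 3)) ∧ ∀ π k, D.IsScaledCoupling (z.1 π) (z.2 π k)}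

theorem convex_mixtures : Convex ℝ D.mixtures := fun _ hz _ hz' _ _ ha hb hab =>
  ⟨convex_stdSimplex ℝ _ hz.1 hz'.1 ha hb hab, fun π k => (hz.2 π k).add_smul (hz'.2 π k) ha hb⟩

theorem isScaledCoupling_iff {θ : ℝ} {K : (∀ j, X j) → A i → Y k × V i → ℝ} :
    D.IsScaledCoupling θ K ↔ (∀ x r z, 0 ≤ K x r z) ∧
      (∀ x r y, ∑ s, K x r (y, s) = θ * W.out k x y) ∧
      ∀ x r s, ∑ y, K x r (y, s) = θ * D.law i r x s :=
  ⟨fun h => ⟨h.1, h.2, h.3⟩, fun h => ⟨h.1, h.2.1, h.2.2⟩⟩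

/-- The constraints are closed, and each kernel entry is at most its output marginal, hence at most
1. -/
theorem isCompact_mixtures [∀ k, Fintype (A k)] : IsCompact D.mixtures := by
  refine Metric.isCompact_of_isClosed_isBounded ?_ ?_
  · have h : IsClosed {z : KernelSpace X Y A V | ∀ π k, D.IsScaledCoupling (z.1 π) (z.2 π k)} := by
      simp only [isScaledCoupling_iff, Set.ofPred_forall, Set.ofPred_and]
      refine isClosed_iInter fun π => isClosed_iInter fun k => ?_
      refine IsClosed.inter ?_ (IsClosed.inter ?_ ?_) <;>
      · refine isClosed_iInter fun _ => isClosed_iInter fun _ => isClosed_iInter fun _ => ?_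
        first
        | exact isClosed_le (by fun_prop) (by fun_prop)
        | exact isClosed_eq (by fun_prop) (by fun_prop)
    exact ((isClosed_stdSimplex ℝ _).preimage continuous_fst).inter h
  · refine Metric.isBounded_closedBall (x := (0 : KernelSpace X Y A V)) (r := 1) |>.subset ?_
    rintro ⟨θ, K⟩ ⟨hθ, hK⟩
    simp only at hθ hK
    have hθ1 : ∀ π, θ π ≤ 1 := fun π => by
      rw [← hθ.2]; exact Finset.single_le_sum (fun π _ => hθ.1 π) (Finset.mem_univ π)
    rw [mem_closedBall_zero_iff, Prod.norm_mk, max_le_iff]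
    refine ⟨(pi_norm_le_iff_of_nonneg zero_le_one).2 fun π => ?_, ?_⟩
    · rw [Real.norm_of_nonneg (hθ.1 π)]; exact hθ1 π
    · refine (pi_norm_le_iff_of_nonneg zero_le_one).2 fun π =>
        (pi_norm_le_iff_of_nonneg zero_le_one).2 fun k =>
        (pi_norm_le_iff_of_nonneg zero_le_one).2 fun x =>
        (pi_norm_le_iff_of_nonneg zero_le_one).2 fun r =>
        (pi_norm_le_iff_of_nonneg zero_le_one).2 fun ⟨y, s⟩ => ?_
      have h := hK π k
      rw [Real.norm_of_nonneg (h.nonneg x r (y, s))]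
      have hout : W.out k x y ≤ 1 := by
        rw [← W.sum_out k x]
        exact Finset.single_le_sum (fun y _ => W.out_nonneg k x y) (Finset.mem_univ y)
      calc K π k x r (y, s) ≤ ∑ s, K π k x r (y, s) :=
            Finset.single_le_sum (f := fun s => K π k x r (y, s)) (fun _ _ => h.nonneg _ _ _)
              (Finset.mem_univ s)
        _ = θ π * W.out k x y := h.fst x r y
        _ ≤ 1 := mul_le_one₀ (hθ1 π) (W.out_nonneg k x y) hout

/-- If the mean bound can be met, up to every `ε`, by some finite family of input laws, then a
single finite mixture of input laws meets it for all permutations and couplings. -/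
theorem exists_finite_mixture_of_forall [∀ k, Fintype (A k)] [Nonempty (InputLaws X)] {ρ : ℝ}
    (h : ∀ ε > 0, ∃ (n : ℕ) (p : Fin n → InputLaws X), 0 < n ∧
      ∀ (π : Equiv.Perm (Fin 3)) (J : ∀ k, (∀ j, X j) → A (π k) → Y k × V (π k) → ℝ),
        (∀ k, D.IsScaledCoupling 1 (J k)) → n * (ρ - ε) ≤ ∑ t, ∑ k, D.term (p t).1 (J k)) :
    ∃ (m : ℕ) (p : Fin m → InputLaws X) (l : Fin m → ℝ), l ∈ stdSimplex ℝ (Fin m) ∧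
      ∀ (π : Equiv.Perm (Fin 3)) (J : ∀ k, (∀ j, X j) → A (π k) → Y k × V (π k) → ℝ),
        (∀ k, D.IsScaledCoupling 1 (J k)) → ρ ≤ ∑ q, l q * ∑ k, D.term (p q).1 (J k) := by
  obtain ⟨m, p, l, hl, hm⟩ := exists_finite_mixture D.convex_mixtures D.isCompact_mixtures
    (fun (p : InputLaws X) z => ∑ π, ∑ k, D.term p.1 (z.2 π k)) (c := ρ)
    (fun p => ⟨D.convex_mixtures, fun z hz z' hz' a b ha hb _ => by
      simp only [smul_eq_mul, Finset.mul_sum, ← Finset.sum_add_distrib]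
      exact Finset.sum_le_sum fun π _ => Finset.sum_le_sum fun k _ =>
        term_add_smul_le p.2 (hz.2 π k) (hz'.2 π k) ha hb⟩)
    (fun p => continuousOn_finsetSum _ fun π _ => continuousOn_finsetSum _ fun k _ =>
      (D.continuousOn_term_right p.2).comp (by fun_prop) fun z hz => (hz.2 π k).nonneg)
    (fun z hz => continuous_finsetSum _ fun π _ => continuous_finsetSum _ fun k _ =>
      D.continuous_term_left (hz.2 π k).nonneg)
    (fun ε hε z hz => by
      obtain ⟨n, p, hn, hp⟩ := h ε hε
      -- At a fixed mixture of couplings, the mean over the `n` input laws is large, so one of them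
      -- must be large. This pointwise bound is all that the minimax argument needs.
      by_contra! hcon
      have h1 : ∑ t, ∑ π, ∑ k, D.term (p t).1 (z.2 π k) < ∑ _t : Fin n, (ρ - ε) :=
        Finset.sum_lt_sum_of_nonempty ⟨⟨0, hn⟩, Finset.mem_univ _⟩ fun t _ => hcon (p t)
      have h2 : ∀ π, z.1 π * (n * (ρ - ε)) ≤ ∑ t, ∑ k, D.term (p t).1 (z.2 π k) := by
        intro π
        rcases (hz.1.1 π).eq_or_lt with h0 | h0
        -- A permutation of weight zero has nonnegative kernels with zero marginals, so they vanish;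
        -- for positive weight, dividing by the weight gives true couplings.
        · have hz0 : ∀ k, z.2 π k = (0 : ℝ) • z.2 π k := fun k => by
            ext x r ⟨y, s⟩
            have := (hz.2 π k).fst x r y
            rw [← h0, zero_mul] at this
            simpa using (Finset.sum_eq_zero_iff_of_nonneg
              fun s _ => (hz.2 π k).nonneg x r (y, s)).1 this s (Finset.mem_univ s)
          have : ∀ t k, D.term (p t).1 (z.2 π k) = 0 := fun t k => by
            rw [hz0 k, term_smul, zero_mul]
          simp [this, ← h0]
        · have := hp π (fun k => (z.1 π)⁻¹ • z.2 π k) fun k =>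
            ⟨fun x r w => mul_nonneg (inv_nonneg.2 h0.le) ((hz.2 π k).nonneg _ _ _),
             fun x r y => by
               simp only [Pi.smul_apply, smul_eq_mul, ← Finset.mul_sum, (hz.2 π k).fst]
               field_simp,
             fun x r y => by
               simp only [Pi.smul_apply, smul_eq_mul, ← Finset.mul_sum, (hz.2 π k).snd]
               field_simp⟩
          simp only [term_smul, ← Finset.mul_sum] at this
          rwa [← div_eq_inv_mul, le_div_iff₀' h0] at this
      have h3 := Finset.sum_le_sum fun π (_ : π ∈ Finset.univ) => h2 π
      rw [← Finset.sum_mul, hz.1.2, Finset.sum_comm, one_mul] at h3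
      simp at h1
      linarith)
  refine ⟨m, p, l, hl, fun π J hJ => ?_⟩
  classical
  have h0 : ∀ π' k, D.IsScaledCoupling ((Pi.single π 1 : Equiv.Perm (Fin 3) → ℝ) π')
      ((Pi.single π J : ∀ (π' : Equiv.Perm (Fin 3)) (k : Fin 3),
        (∀ j, X j) → A (π' k) → Y k × V (π' k) → ℝ) π' k) := by
    intro π' k
    rcases eq_or_ne π' π with rfl | hne
    · simpa using hJ k
    · simp only [Pi.single_eq_of_ne hne]
      exact ⟨by simp, by simp, by simp⟩
  -- A single permutation with its couplings is a vertex: all weight on `π`.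
  have := hm (Pi.single π 1, Pi.single π J) ⟨single_mem_stdSimplex ℝ π, h0⟩
  refine this.trans (le_of_eq (Finset.sum_congr rfl fun q _ => ?_))
  congr 1
  rw [Finset.sum_eq_single π]
  · simp
  · intro π' _ hne
    refine Finset.sum_eq_zero fun k _ => ?_
    simp only [Pi.single_eq_of_ne hne]
    have := D.term_smul (p q).1 0 (0 : (∀ j, X j) → A (π' k) → Y k × V (π' k) → ℝ)
    simpa using this
  · simp

end RefRemoval

end SingleLetter

/-! ### Product laws and marginalisation. -/

section Product

variable {ι : Type*} [Fintype ι] [DecidableEq ι]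

theorem prob_prod {Z U : ι → Type*} [∀ i, Fintype (Z i)] (g : ∀ i, Z i → ℝ) (φ : ∀ i, Z i → U i)
    (u : ∀ i, U i) :
    prob (fun z : ∀ i, Z i => ∏ i, g i (z i)) (fun z => (fun i => φ i (z i)) = u) =
      ∏ i, prob (g i) (fun a => φ i a = u i) := by
  classical
  simp only [prob]
  rw [Fintype.prod_sum]
  refine Finset.sum_congr rfl fun z _ => ?_
  rw [Finset.prod_ite_zero]
  simp [funext_iff]

theorem sum_prod_mul_apply {Z : Type*} [Fintype Z] (g : ι → Z → ℝ) (hg : ∀ i, ∑ a, g i a = 1)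
    (i : ι) (h : Z → ℝ) : ∑ z : ι → Z, (∏ j, g j (z j)) * h (z i) = ∑ a, g i a * h a := by
  classical
  have e : ∀ z : ι → Z, (∏ j, g j (z j)) * h (z i) =
      ∏ j, g j (z j) * (if j = i then h (z j) else 1) := fun z => by
    rw [Finset.prod_mul_distrib, Finset.prod_ite_eq' Finset.univ i (fun j => h (z j))]
    simp
  simp only [e]
  rw [← Fintype.prod_sum (fun j a => g j a * (if j = i then h a else 1)),
    Finset.prod_eq_single i]
  · simp
  · intro j _ hj
    simp [hj, hg]
  · simp

/-- All slices in direction `i` have the same sum. This allows message `i` to be set equal to its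
copy. -/
theorem sum_eq_card_mul_sum_ite {β : ι → Type*}
    [∀ i, Fintype (β i)] [∀ i, DecidableEq (β i)]
    (F : (∀ i, β i) → ℝ) (i : ι) (hF : ∀ w a, F (Function.update w i a) = F w) (v : β i) :
    ∑ w, F w = Fintype.card (β i) * ∑ w, if w i = v then F w else 0 := by
  have hv : ∀ a b, F ((Equiv.piSplitAt i β).symm (a, b)) =
      F ((Equiv.piSplitAt i β).symm (v, b)) := by
    intro a b
    rw [← hF _ v]
    congr 1
    ext j
    by_cases h : j = i
    · subst h; simp
    · simp [h]
  rw [← (Equiv.piSplitAt i β).symm.sum_comp F,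
    ← (Equiv.piSplitAt i β).symm.sum_comp (fun w => if w i = v then F w else 0),
    Fintype.sum_prod_type, Fintype.sum_prod_type]
  simp [hv]

theorem prob_prod_type {Ω Ω' : Type*} [Fintype Ω] [Fintype Ω'] (p : Ω × Ω' → ℝ)
    (E : Ω × Ω' → Prop) : prob p E = ∑ ω, prob (fun ω' => p (ω, ω')) (fun ω' => E (ω, ω')) := by
  classical
  simp only [prob, Fintype.sum_prod_type]

theorem prob_const_mul {Ω : Type*} [Fintype Ω] (c : ℝ) (p : Ω → ℝ) (E : Ω → Prop) :
    prob (fun ω => c * p ω) E = c * prob p E := prob_smul c p E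

end Product

/-! ### Block codes and Fano's inequality. -/

section Converse

variable {X Y : Fin 3 → Type*} {n : ℕ}

namespace Code

variable (C : Code X Y n)

/-- The channel inputs at time `t`. -/
def input (t : Fin n) (w : ∀ j, Fin (C.M j)) : ∀ j, X j := fun j => C.enc j (w j) t

/-- The law of the inputs at time `t`. -/
noncomputable def inputLaw (t : Fin n) (j : Fin 3) (a : X j) : ℝ :=
  prob (fun _ : Fin (C.M j) => (C.M j : ℝ)⁻¹) (fun w => C.enc j w t = a)

variable {C}

theorem inputLaw_mem [∀ k, Fintype (X k)] (hM : ∀ k, 0 < C.M k) (t : Fin n) (j : Fin 3) :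
    C.inputLaw t j ∈ stdSimplex ℝ (X j) := by
  refine ⟨fun a => prob_nonneg (fun _ => by positivity) _, ?_⟩
  have := hM j
  simp only [inputLaw, sum_prob_eq]
  simp
  field_simp

/-- Independent messages and separate encoders make the three inputs at each time independent. -/
theorem sum_comp_input [∀ k, Fintype (X k)] (t : Fin n) (G : (∀ j, X j) → ℝ) :
    ∑ w : ∀ j, Fin (C.M j), (∏ j, (C.M j : ℝ))⁻¹ * G (C.input t w) =
      ∑ x : ∀ j, X j, (∏ j, C.inputLaw t j (x j)) * G x := by
  rw [← Finset.prod_inv_distrib]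
  rw [← sum_prob_mul (fun _ : ∀ j, Fin (C.M j) => ∏ j, (C.M j : ℝ)⁻¹) (C.input t) G]
  refine Finset.sum_congr rfl fun x _ => ?_
  congr 1
  exact prob_prod (fun j (_ : Fin (C.M j)) => (C.M j : ℝ)⁻¹) (fun j w => C.enc j w t) x

theorem sum_uniform (hM : ∀ k, 0 < C.M k) :
    ∑ _w : ∀ j, Fin (C.M j), (∏ j, (C.M j : ℝ))⁻¹ = 1 := by
  have : (∏ j, (C.M j : ℝ)) ≠ 0 := Finset.prod_ne_zero_iff.2 fun j _ => by
    have := hM j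
    positivity
  simp only [Finset.sum_const, Finset.card_univ, Fintype.card_pi, Fintype.card_fin, nsmul_eq_mul,
    Nat.cast_prod]
  exact mul_inv_cancel₀ this

end Code

variable [∀ k, Fintype (X k)] [∀ k, Fintype (Y k)] {W : Channel X Y}

namespace Code

/-- Joint mass function of the messages and the output sequence at destination `k`. -/
noncomputable def outMass (C : Code X Y n) (W : Channel X Y) (k : Fin 3) :
    (∀ j, Fin (C.M j)) × (Fin n → Y k) → ℝ :=
  fun z => (∏ j, (C.M j : ℝ))⁻¹ * ∏ t, W.out k (C.input t z.1) (z.2 t)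

variable {C : Code X Y n}

theorem sum_prod_out (W : Channel X Y) (k : Fin 3) (w : ∀ j, Fin (C.M j)) :
    ∑ u : Fin n → Y k, ∏ t, W.out k (C.input t w) (u t) = 1 := by
  classical
  rw [← Fintype.prod_sum (fun t a => W.out k (C.input t w) a)]
  exact Finset.prod_eq_one fun t _ => W.sum_out k _

theorem outMass_nonneg (k : Fin 3) (z : (∀ j, Fin (C.M j)) × (Fin n → Y k)) :
    0 ≤ C.outMass W k z :=
  mul_nonneg (inv_nonneg.2 (Finset.prod_nonneg fun _ _ => Nat.cast_nonneg _))
    (Finset.prod_nonneg fun _ _ => W.out_nonneg _ _ _)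

theorem sum_outMass (hM : ∀ k, 0 < C.M k) (k : Fin 3) : ∑ z, C.outMass W k z = 1 := by
  simp only [Fintype.sum_prod_type, outMass]
  simp only [← Finset.mul_sum (s := (Finset.univ : Finset (Fin n → Y k))), sum_prod_out, mul_one]
  exact sum_uniform hM

/-- The output sequence at one destination is a marginal of the full output, and its decoding error
is part of the event that some destination errs. -/
theorem sum_outMass_error_le (k : Fin 3) :
    prob (C.outMass W k) (fun z => C.dec k z.2 ≠ z.1 k) ≤ W.errorProb C := by
  classical
  rw [prob_prod_type, Channel.errorProb, div_eq_inv_mul, Finset.mul_sum]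
  refine Finset.sum_le_sum fun w _ => ?_
  simp only [outMass]
  rw [prob_const_mul]
  refine mul_le_mul_of_nonneg_left ?_
    (inv_nonneg.2 (Finset.prod_nonneg fun _ _ => Nat.cast_nonneg _))
  have h1 : ∀ u : Fin n → Y k, ∏ t, W.out k (C.input t w) (u t) =
      prob (fun y : Fin n → ∀ k, Y k => ∏ t, W.law (C.input t w) (y t))
        (fun y => (fun t => y t k) = u) := fun u =>
    (prob_prod (fun t => W.law (C.input t w)) (fun _ z => z k) u).symm
  have h2 : prob (fun u : Fin n → Y k => ∏ t, W.out k (C.input t w) (u t))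
      (fun u => C.dec k u ≠ w k) =
      prob (fun y : Fin n → ∀ k, Y k => ∏ t, W.law (C.input t w) (y t))
        (fun y => C.dec k (fun t => y t k) ≠ w k) := by
    have := sum_prob_mul (fun y : Fin n → ∀ k, Y k => ∏ t, W.law (C.input t w) (y t))
      (fun y => (fun t => y t k)) (fun u => if C.dec k u ≠ w k then 1 else 0)
    simp only [← h1, mul_ite, mul_one, mul_zero] at this
    simp only [prob]
    convert this
  rw [h2]
  exact prob_mono (fun y => Finset.prod_nonneg fun _ _ => (W.law_mem _).1 _) fun y h => ⟨k, h⟩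

/-- Fano's inequality. -/
theorem one_sub_errorProb_mul_log_le (hM : ∀ k, 0 < C.M k) (k : Fin 3) :
    (1 - W.errorProb C) * Real.log (C.M k) ≤ entropy (C.outMass W k) (fun z => z.2) -
      (entropy (C.outMass W k) (fun z => (z.1 k, z.2)) - Real.log (C.M k)) + Real.log 2 := by
  classical
  have hMk : (0 : ℝ) < C.M k := by exact_mod_cast hM k
  have hlog : 0 ≤ Real.log (C.M k) := Real.log_nonneg (by exact_mod_cast hM k)
  have hg := condEntropy_le_neg_sum (outMass_nonneg (W := W) k) (fun z => z.1 k) (fun z => z.2)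
    -- The guess puts half its mass on the decoded message and spreads half uniformly. It costs at
    -- most log 2 when decoding is right and at most log 2 + log M when it is wrong.
    (fun a u => (if a = C.dec k u then 1 / 2 else 0) + 1 / (2 * C.M k))
    (fun a u => by split_ifs <;> positivity)
    (fun u => by
      rw [Finset.sum_add_distrib]
      simp
      field_simp
      norm_num)
    (fun z _ => by split_ifs <;> positivity)
  rw [condEntropy_eq_sub (outMass_nonneg k)] at hg
  have hb : -∑ z, C.outMass W k z *
      Real.log ((if z.1 k = C.dec k z.2 then 1 / 2 else 0) + 1 / (2 * (C.M k : ℝ))) ≤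
      ∑ z, (C.outMass W k z * Real.log 2 +
        (if C.dec k z.2 ≠ z.1 k then C.outMass W k z else 0) * Real.log (C.M k)) := by
    rw [← Finset.sum_neg_distrib]
    refine Finset.sum_le_sum fun z _ => ?_
    have h0 := outMass_nonneg (W := W) k z
    by_cases h : z.1 k = C.dec k z.2
    · have : Real.log (1 / 2) ≤ Real.log (1 / 2 + 1 / (2 * (C.M k : ℝ))) :=
        Real.log_le_log (by norm_num) (le_add_of_nonneg_right (by positivity))
      rw [one_div, Real.log_inv] at this
      simp only [h, if_true, ne_eq, not_true, if_false]
      have := mul_le_mul_of_nonneg_left this h0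
      rw [one_div]
      linarith
    · have h' : C.dec k z.2 ≠ z.1 k := fun e => h e.symm
      simp only [h, h', if_false, ne_eq, not_false_eq_true, if_true, zero_add]
      rw [one_div, Real.log_inv, Real.log_mul two_ne_zero hMk.ne']
      linarith
  rw [Finset.sum_add_distrib, ← Finset.sum_mul, ← Finset.sum_mul, sum_outMass hM] at hb
  have he := mul_le_mul_of_nonneg_right (sum_outMass_error_le (W := W) (C := C) k) hlog
  have hp : prob (C.outMass W k) (fun z => C.dec k z.2 ≠ z.1 k) =
      ∑ z, if C.dec k z.2 ≠ z.1 k then C.outMass W k z else 0 := by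
    simp only [prob]
    congr!
  rw [hp] at he
  have := hg.trans hb
  linarith

end Code

/-! ### Block entropies against single-letter entropies. -/

namespace RefRemoval

variable {A V : Fin 3 → Type*} [∀ k, Fintype (V k)]
  (D : RefRemoval W A V) (C : Code X Y n) {k i : Fin 3}

/-- Joint mass function of the messages, an independent copy of message `i`, and the sequence of
pairs of outputs and signals. -/
noncomputable def seqMass (J : (∀ j, X j) → A i → Y k × V i → ℝ) :
    (∀ j, Fin (C.M j)) × Fin (C.M i) × (Fin n → Y k × V i) → ℝ :=
  fun z => (∏ j, (C.M j : ℝ))⁻¹ * ((C.M i : ℝ)⁻¹ *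
    ∏ t, J (C.input t z.1) (D.ref i (C.enc i z.2.1 t)) (z.2.2 t))

variable {D C} {J : (∀ j, X j) → A i → Y k × V i → ℝ}

theorem seqMass_nonneg (hJ : D.IsScaledCoupling 1 J)
    (z : (∀ j, Fin (C.M j)) × Fin (C.M i) × (Fin n → Y k × V i)) : 0 ≤ D.seqMass C J z :=
  mul_nonneg (inv_nonneg.2 (Finset.prod_nonneg fun _ _ => Nat.cast_nonneg _))
    (mul_nonneg (inv_nonneg.2 (Nat.cast_nonneg _))
      (Finset.prod_nonneg fun _ _ => hJ.nonneg _ _ _))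

theorem IsScaledCoupling.sum_eq_one (hJ : D.IsScaledCoupling 1 J) (x : ∀ j, X j) (r : A i) :
    ∑ z, J x r z = 1 := by
  rw [Fintype.sum_prod_type]
  simp only [hJ.fst, one_mul, W.sum_out]

theorem IsScaledCoupling.prob_fst (hJ : D.IsScaledCoupling 1 J) (x : ∀ j, X j) (r : A i) (y : Y k) :
    prob (J x r) (fun z => z.1 = y) = W.out k x y := by
  rw [prob_eq_sum_of_equiv (Equiv.refl _) _ _ (fun _ => rfl)]
  simpa using hJ.fst x r y

theorem IsScaledCoupling.prob_snd (hJ : D.IsScaledCoupling 1 J) (x : ∀ j, X j) (r : A i) (s : V i) :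
    prob (J x r) (fun z => z.2 = s) = D.law i r x s := by
  rw [prob_eq_sum_of_equiv (Equiv.prodComm _ _) _ _ (fun _ => rfl)]
  simpa using hJ.snd x r s

theorem sum_refLaw_inputLaw_mul [∀ k, Fintype (A k)] (t : Fin n) (F : A i → ℝ) :
    ∑ v : Fin (C.M i), (C.M i : ℝ)⁻¹ * F (D.ref i (C.enc i v t)) =
      ∑ r, D.refLaw (C.inputLaw t) i r * F r := by
  simp only [refLaw]
  rw [sum_prob_mul]
  exact (sum_prob_mul (fun _ : Fin (C.M i) => (C.M i : ℝ)⁻¹) (fun v => C.enc i v t)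
    (fun x => F (D.ref i x))).symm

/-- At time `t` the inputs, reference, output and signal have the single-letter law of the inputs at
time `t`. -/
theorem sum_seqMass_mul [∀ k, Fintype (A k)] (hJ : D.IsScaledCoupling 1 J) (t : Fin n)
    (h : (∀ j, X j) × A i × Y k × V i → ℝ) :
    ∑ z, D.seqMass C J z * h (C.input t z.1, D.ref i (C.enc i z.2.1 t), z.2.2 t) =
      ∑ z, D.mass (C.inputLaw t) J z * h z := by
  have hl : ∑ z, D.seqMass C J z * h (C.input t z.1, D.ref i (C.enc i z.2.1 t), z.2.2 t) =
      ∑ w : ∀ j, Fin (C.M j), (∏ j, (C.M j : ℝ))⁻¹ * ∑ v : Fin (C.M i), (C.M i : ℝ)⁻¹ *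
        ∑ a, J (C.input t w) (D.ref i (C.enc i v t)) a *
          h (C.input t w, D.ref i (C.enc i v t), a) := by
    rw [Fintype.sum_prod_type]
    refine Finset.sum_congr rfl fun w _ => ?_
    rw [Fintype.sum_prod_type, Finset.mul_sum]
    refine Finset.sum_congr rfl fun v _ => ?_
    rw [← sum_prod_mul_apply (fun t => J (C.input t w) (D.ref i (C.enc i v t)))
      (fun t => hJ.sum_eq_one _ _) t (fun a => h (C.input t w, D.ref i (C.enc i v t), a)),
      Finset.mul_sum, Finset.mul_sum]
    exact Finset.sum_congr rfl fun u _ => by simp only [seqMass]; ring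
  have hr : ∑ z, D.mass (C.inputLaw t) J z * h z =
      ∑ x : ∀ j, X j, (∏ j, C.inputLaw t j (x j)) * ∑ r, D.refLaw (C.inputLaw t) i r *
        ∑ a, J x r a * h (x, r, a) := by
    rw [Fintype.sum_prod_type]
    refine Finset.sum_congr rfl fun x _ => ?_
    rw [Fintype.sum_prod_type, Finset.mul_sum]
    refine Finset.sum_congr rfl fun r _ => ?_
    rw [Finset.mul_sum, Finset.mul_sum]
    exact Finset.sum_congr rfl fun a _ => by simp only [mass]; ring
  rw [hl, hr, ← Code.sum_comp_input t (fun x => ∑ r, D.refLaw (C.inputLaw t) i r *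
    ∑ a, J x r a * h (x, r, a))]
  refine Finset.sum_congr rfl fun w _ => ?_
  rw [← sum_refLaw_inputLaw_mul t (fun r => ∑ a, J (C.input t w) r a * h (C.input t w, r, a))]

/-- Keeps the single-letter conditional laws positive wherever their logarithms are taken. -/
theorem mass_pos_of_seqMass_pos [∀ k, Fintype (A k)] (hJ : D.IsScaledCoupling 1 J) (t : Fin n)
    {z : (∀ j, Fin (C.M j)) × Fin (C.M i) × (Fin n → Y k × V i)} (hz : 0 < D.seqMass C J z) :
    0 < D.mass (C.inputLaw t) J (C.input t z.1, D.ref i (C.enc i z.2.1 t), z.2.2 t) := by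
  classical
  have h := sum_seqMass_mul (C := C) hJ t (fun a =>
    if a = (C.input t z.1, D.ref i (C.enc i z.2.1 t), z.2.2 t) then 1 else 0)
  simp only [mul_ite, mul_one, mul_zero, Finset.sum_ite_eq', Finset.mem_univ, if_true] at h
  rw [← h]
  refine hz.trans_le ?_
  have := Finset.single_le_sum (f := fun z' : (∀ j, Fin (C.M j)) × Fin (C.M i) ×
    (Fin n → Y k × V i) => if (C.input t z'.1, D.ref i (C.enc i z'.2.1 t),
    z'.2.2 t) = (C.input t z.1, D.ref i (C.enc i z.2.1 t), z.2.2 t) then D.seqMass C J z' else 0)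
    (fun z' _ => by split_ifs; exacts [seqMass_nonneg hJ _, le_rfl]) (Finset.mem_univ z)
  simpa using this

/-- `H(Y^n | S^n, copy)` is at most the sum of its single-letter versions. -/
theorem condEntropy_output_le [∀ k, Fintype (A k)] (hM : ∀ k, 0 < C.M k)
    (hJ : D.IsScaledCoupling 1 J) :
    condEntropy (D.seqMass C J) (fun z t => (z.2.2 t).1) (fun z => (fun t => (z.2.2 t).2, z.2.1)) ≤
      ∑ t, condEntropy (D.mass (C.inputLaw t) J) (fun z => z.2.2.1)
        (fun z => (z.2.2.2, z.2.1)) := by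
  classical
  have hm := fun t => D.mass_nonneg (Code.inputLaw_mem hM t) hJ.nonneg
  -- Gibbs' inequality with the product over time of the single-letter conditional laws replaces the
  -- chain rule followed by dropping conditions.
  let q : Fin n → Y k → V i × A i → ℝ := fun t y b =>
    prob (D.mass (C.inputLaw t) J) (fun z => z.2.2.1 = y ∧ (z.2.2.2, z.2.1) = b) /
      prob (D.mass (C.inputLaw t) J) (fun z => (z.2.2.2, z.2.1) = b)
  have hq : ∀ t y b, 0 ≤ q t y b := fun t y b =>
    div_nonneg (prob_nonneg (hm t) _) (prob_nonneg (hm t) _)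
  have hqpos : ∀ z, 0 < D.seqMass C J z → ∀ t,
      0 < q t (z.2.2 t).1 ((z.2.2 t).2, D.ref i (C.enc i z.2.1 t)) := fun z hz t => by
    have := mass_pos_of_seqMass_pos hJ t hz
    exact div_pos
      (this.trans_le (le_prob (E := fun z' => z'.2.2.1 = (z.2.2 t).1 ∧
        (z'.2.2.2, z'.2.1) = ((z.2.2 t).2, D.ref i (C.enc i z.2.1 t))) (hm t) ⟨rfl, rfl⟩))
      (this.trans_le (le_prob (E := fun z' =>
        (z'.2.2.2, z'.2.1) = ((z.2.2 t).2, D.ref i (C.enc i z.2.1 t))) (hm t) rfl))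
  have hg := condEntropy_le_neg_sum (seqMass_nonneg (C := C) hJ) (fun z t => (z.2.2 t).1)
    (fun z => (fun t => (z.2.2 t).2, z.2.1))
    (fun y b => ∏ t, q t (y t) (b.1 t, D.ref i (C.enc i b.2 t)))
    (fun y b => Finset.prod_nonneg fun t _ => hq _ _ _)
    (fun b => by
      rw [← Fintype.prod_sum (fun t y => q t y (b.1 t, D.ref i (C.enc i b.2 t)))]
      refine Finset.prod_le_one (fun t _ => Finset.sum_nonneg fun _ _ => hq _ _ _) fun t _ => ?_
      simp only [q]
      rw [← Finset.sum_div, sum_prob_and]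
      exact div_self_le_one _)
    (fun z hz => Finset.prod_pos fun t _ => hqpos z hz t)
  refine hg.trans (le_of_eq ?_)
  have e : ∀ z, D.seqMass C J z *
      Real.log (∏ t, q t (z.2.2 t).1 ((z.2.2 t).2, D.ref i (C.enc i z.2.1 t))) =
      ∑ t, D.seqMass C J z *
        Real.log (q t (z.2.2 t).1 ((z.2.2 t).2, D.ref i (C.enc i z.2.1 t))) := fun z => by
    rcases (seqMass_nonneg (C := C) hJ z).eq_or_lt with h | h
    · simp [← h]
    · rw [Real.log_prod (fun t _ => (hqpos z h t).ne'), Finset.mul_sum]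
  simp only [e]
  rw [Finset.sum_comm, ← Finset.sum_neg_distrib]
  refine Finset.sum_congr rfl fun t _ => ?_
  rw [condEntropy_eq_neg_sum (hm t)]
  congr 1
  exact sum_seqMass_mul hJ t (fun z => Real.log (q t z.2.2.1 (z.2.2.2, z.2.1)))

/-- `H(S^n | Y^n, copy)` is at least the sum of the single-letter versions given all inputs. -/
theorem le_condEntropy_signal [∀ k, Fintype (A k)] (hM : ∀ k, 0 < C.M k)
    (hJ : D.IsScaledCoupling 1 J) :
    ∑ t, condEntropy (D.mass (C.inputLaw t) J) (fun z => z.2.2.2)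
        (fun z => (z.2.2.1, z.1, z.2.1)) ≤
      condEntropy (D.seqMass C J) (fun z t => (z.2.2 t).2)
        (fun z => (fun t => (z.2.2 t).1, z.2.1)) := by
  classical
  have hm := fun t => D.mass_nonneg (Code.inputLaw_mem hM t) hJ.nonneg
  have hs := seqMass_nonneg (C := C) hJ
  -- Conditioning on all messages as well only lowers the entropy. After that the channel uses are
  -- independent and the sum over time is an equality.
  refine le_trans (le_of_eq ?_) (condEntropy_le_of_comp hs (fun z t => (z.2.2 t).2)
    (fun z => ((fun t => (z.2.2 t).1), z.1, z.2.1)) (fun b => (b.1, b.2.2)))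
  -- The log of the conditional law of the signal given output, inputs and reference; it does not
  -- depend on the input laws, so it is the same at every time.
  let g : (∀ j, X j) × A i × Y k × V i → ℝ := fun z =>
    Real.log (J z.1 z.2.1 z.2.2 / W.out k z.1 z.2.2.1)
  have hsingle : ∀ t, condEntropy (D.mass (C.inputLaw t) J) (fun z => z.2.2.2)
      (fun z => (z.2.2.1, z.1, z.2.1)) = -∑ z, D.mass (C.inputLaw t) J z * g z := by
    intro t
    rw [condEntropy_eq_neg_sum (hm t)]
    congr 1
    refine Finset.sum_congr rfl fun ⟨x, r, y, s⟩ _ => ?_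
    rcases (hm t (x, r, y, s)).eq_or_lt with h | h
    · simp [← h]
    congr 2
    have h1 : prob (D.mass (C.inputLaw t) J)
        (fun z => z.2.2.2 = s ∧ (z.2.2.1, z.1, z.2.1) = (y, x, r)) =
        D.mass (C.inputLaw t) J (x, r, y, s) := by
      rw [prob, Finset.sum_eq_single (x, r, y, s)]
      · simp
      · rintro ⟨x', r', y', s'⟩ _ hne
        refine if_neg fun hh => hne ?_
        simp_all
      · simp
    have h2 : prob (D.mass (C.inputLaw t) J) (fun z => (z.2.2.1, z.1, z.2.1) = (y, x, r)) =
        (∏ j, C.inputLaw t j (x j)) * D.refLaw (C.inputLaw t) i r * W.out k x y := by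
      rw [prob_eq_sum_of_equiv (γ := V i)
        ⟨fun z => (z.1.2.1, z.1.2.2, z.1.1, z.2), fun z => ((z.2.2.1, z.1, z.2.1), z.2.2.2),
          fun _ => rfl, fun _ => rfl⟩ _ _ (fun _ => rfl)]
      simp only [mass, Equiv.coe_fn_mk, ← Finset.mul_sum, hJ.fst, one_mul]
    dsimp only
    rw [h1, h2]
    simp only [mass] at h ⊢
    exact mul_div_mul_left _ _ (left_ne_zero_of_mul h.ne')
  simp only [hsingle]
  rw [condEntropy_eq_neg_sum hs, Finset.sum_neg_distrib, neg_inj]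
  simp only [← sum_seqMass_mul (C := C) hJ]
  rw [Finset.sum_comm]
  refine Finset.sum_congr rfl fun ⟨w, v, u⟩ _ => ?_
  rcases (hs (w, v, u)).eq_or_lt with h | h
  · simp [← h]
  rw [← Finset.mul_sum]
  congr 1
  have h1 : prob (D.seqMass C J) (fun z => (fun t => (z.2.2 t).2) = (fun t => (u t).2) ∧
      ((fun t => (z.2.2 t).1), z.1, z.2.1) = ((fun t => (u t).1), w, v)) =
      D.seqMass C J (w, v, u) := by
    rw [prob, Finset.sum_eq_single (w, v, u)]
    · simp
    · rintro ⟨w', v', u'⟩ _ hne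
      refine if_neg fun hh => hne ?_
      obtain ⟨h1, h2⟩ := hh
      simp only [Prod.mk.injEq] at h2 ⊢
      refine ⟨h2.2.1, h2.2.2, funext fun t => Prod.ext (congrFun h2.1 t) (congrFun h1 t)⟩
    · simp
  have h2 : prob (D.seqMass C J) (fun z => ((fun t => (z.2.2 t).1), z.1, z.2.1) =
      ((fun t => (u t).1), w, v)) =
      (∏ j, (C.M j : ℝ))⁻¹ * ((C.M i : ℝ)⁻¹ * ∏ t, W.out k (C.input t w) (u t).1) := by
    rw [prob_eq_sum_of_equiv (γ := Fin n → V i)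
      ⟨fun z => (z.1.2.1, z.1.2.2, fun t => (z.1.1 t, z.2 t)),
        fun z => ((fun t => (z.2.2 t).1, z.1, z.2.1), fun t => (z.2.2 t).2),
        fun _ => rfl, fun _ => rfl⟩ _ _ (fun _ => rfl)]
    simp only [seqMass, Equiv.coe_fn_mk, ← Finset.mul_sum]
    rw [← Fintype.prod_sum (fun t s => J (C.input t w) (D.ref i (C.enc i v t)) ((u t).1, s))]
    simp only [hJ.fst, one_mul]
  dsimp only
  rw [h1, h2]
  have hne : ∀ t, J (C.input t w) (D.ref i (C.enc i v t)) (u t) ≠ 0 := by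
    simp only [seqMass] at h
    exact fun t => Finset.prod_ne_zero_iff.1
      (right_ne_zero_of_mul (right_ne_zero_of_mul h.ne')) t (Finset.mem_univ t)
  have hne2 : ∀ t, W.out k (C.input t w) (u t).1 ≠ 0 := fun t h0 => by
    have h3 := hJ.fst (C.input t w) (D.ref i (C.enc i v t)) (u t).1
    rw [h0, mul_zero] at h3
    exact hne t ((Finset.sum_eq_zero_iff_of_nonneg fun s _ => hJ.nonneg _ _ _).1 h3 (u t).2
      (Finset.mem_univ _))
  have hc : (∏ j, (C.M j : ℝ))⁻¹ ≠ 0 := left_ne_zero_of_mul (by simpa only [seqMass] using h.ne')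
  have hc2 : (C.M i : ℝ)⁻¹ ≠ 0 := by
    have := hM i
    positivity
  simp only [seqMass]
  rw [mul_div_mul_left _ _ hc, mul_div_mul_left _ _ hc2, ← Finset.prod_div_distrib,
    Real.log_prod fun t _ => div_ne_zero (hne t) (hne2 t)]

end RefRemoval

end Converse

/-! ### Relabelling and time sharing in conditional entropies. -/

section Transfer

variable {Ω Ω' α β γ : Type*} [Fintype Ω] [Fintype Ω'] [Fintype α] [Fintype β] [Fintype γ]

theorem prob_comp_equiv (e : Ω' ≃ Ω) (p : Ω → ℝ) (E : Ω → Prop) :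
    prob (fun ω => p (e ω)) (fun ω => E (e ω)) = prob p E := by
  classical
  simp only [prob]
  exact e.sum_comp fun ω => if E ω then p ω else 0

theorem condEntropy_comp_equiv (e : Ω' ≃ Ω) (p : Ω → ℝ) (A : Ω → α) (B : Ω → β) :
    condEntropy (fun ω => p (e ω)) (fun ω => A (e ω)) (fun ω => B (e ω)) = condEntropy p A B :=
  condEntropy_congr fun a b => prob_comp_equiv e p fun ω => A ω = a ∧ B ω = b

theorem condEntropy_comp_of_injective {p : Ω → ℝ} (hp : ∀ ω, 0 ≤ p ω) (A : Ω → α) (B : Ω → β)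
    {f : β → γ} (hf : Function.Injective f) :
    condEntropy p A (fun ω => f (B ω)) = condEntropy p A B := by
  rw [condEntropy_eq_sub hp, condEntropy_eq_sub hp, entropy_comp_of_injective p B hf]
  congr 1
  exact entropy_comp_of_injective p (fun ω => (A ω, B ω)) (f := fun z => (z.1, f z.2))
    fun z z' h => Prod.ext (Prod.mk.inj h).1 (hf (Prod.mk.inj h).2)

/-- Conditional entropy given a time-sharing variable is a mean of conditional entropies. -/
theorem condEntropy_timeSharing {m : ℕ} (l : Fin m → ℝ) (p : Fin m → Ω → ℝ) (A : Ω → α)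
    (B : Ω → β) :
    condEntropy (fun z : Fin m × Ω => l z.1 * p z.1 z.2) (fun z => A z.2) (fun z => (B z.2, z.1)) =
      ∑ q, l q * condEntropy (p q) A B := by
  have h : ∀ (E : Ω → Prop) (q : Fin m), prob (fun z : Fin m × Ω => l z.1 * p z.1 z.2)
      (fun z => E z.2 ∧ z.1 = q) = l q * prob (p q) E := fun E q => by
    rw [prob_prod_type, Finset.sum_eq_single q]
    · simp [prob_const_mul]
    · intro q' _ hne
      simp [prob, hne]
    · simp
  have h1 : ∀ b q, prob (fun z : Fin m × Ω => l z.1 * p z.1 z.2) (fun z => (B z.2, z.1) = (b, q)) =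
      l q * prob (p q) (fun ω => B ω = b) := fun b q => by
    simpa only [Prod.mk.injEq] using h (fun ω => B ω = b) q
  have h2 : ∀ a b q, prob (fun z : Fin m × Ω => l z.1 * p z.1 z.2)
      (fun z => A z.2 = a ∧ (B z.2, z.1) = (b, q)) =
      l q * prob (p q) (fun ω => A ω = a ∧ B ω = b) := fun a b q => by
    simpa only [Prod.mk.injEq, and_assoc] using h (fun ω => A ω = a ∧ B ω = b) q
  simp only [condEntropy, Fintype.sum_prod_type_right, h1, h2]
  refine Finset.sum_congr rfl fun q _ => ?_
  by_cases hq : l q = 0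
  · simp [hq]
  · simp only [mul_div_mul_left _ _ hq, mul_assoc, Finset.mul_sum]

end Transfer

/-! ### The sum-rate bound and the passage to the capacity region. -/

section Converse

variable {X Y : Fin 3 → Type*} [∀ k, Fintype (X k)] [∀ k, Fintype (Y k)] {W : Channel X Y} {n : ℕ}

namespace RefRemoval

variable {A V : Fin 3 → Type*} [∀ k, Fintype (V k)]
  {D : RefRemoval W A V} {C : Code X Y n} {k i : Fin 3} {J : (∀ j, X j) → A i → Y k × V i → ℝ}

/-- The output marginal of the coupling ignores the reference, so the output sequence is independent
of the uniform copy. -/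
theorem entropy_output_copy (hM : ∀ k, 0 < C.M k) (hJ : D.IsScaledCoupling 1 J) :
    entropy (D.seqMass C J) (fun z => ((fun t => (z.2.2 t).1), z.2.1)) =
      entropy (C.outMass W k) (fun z => z.2) + Real.log (C.M i) := by
  classical
  have hMi : (C.M i : ℝ) ≠ 0 := by have := hM i; positivity
  have h : ∀ u v, prob (D.seqMass C J) (fun z => ((fun t => (z.2.2 t).1), z.2.1) = (u, v)) =
      prob (C.outMass W k) (fun z => z.2 = u) * (C.M i : ℝ)⁻¹ := by
    intro u v
    rw [prob_prod_type, prob_prod_type, Finset.sum_mul]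
    refine Finset.sum_congr rfl fun w _ => ?_
    rw [prob_prod_type, Finset.sum_eq_single v]
    · simp only [Prod.mk.injEq, and_true, seqMass, Code.outMass, prob_const_mul]
      rw [prob_prod (fun t => J (C.input t w) (D.ref i (C.enc i v t))) (fun _ z => z.1) u]
      simp only [hJ.prob_fst]
      have : prob (fun u' : Fin n → Y k => ∏ t, W.out k (C.input t w) (u' t)) (fun u' => u' = u) =
          ∏ t, W.out k (C.input t w) (u t) := by simp [prob]
      rw [this]
      ring
    · intro v' _ hne
      simp [prob, hne]
    · simp
  have h1 : ∑ u, prob (C.outMass W k) (fun z => z.2 = u) = 1 := by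
    rw [sum_prob_eq, Code.sum_outMass hM]
  rw [entropy, Fintype.sum_prod_type]
  simp only [h, Real.negMulLog_mul, Finset.sum_add_distrib, Finset.sum_const, Finset.card_univ,
    Fintype.card_fin, nsmul_eq_mul, ← Finset.mul_sum, ← Finset.sum_mul, h1]
  rw [entropy, Real.negMulLog, Real.log_inv]
  field_simp

theorem law_combine (i : Fin 3) (x : ∀ j, X j) (s : V i) :
    W.out i x (D.combine i (x i) s) = D.law i (D.ref i (x i)) x s := by
  classical
  rw [D.out_eq]
  simp [prob, (D.combine_injective i (x i)).eq_iff]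

/-- Given the copy, the signal ignores message `i`, which may thus be taken equal to the copy;
symbolwise `combine` then carries the signal injectively to the output at destination `i`, and
output sequences outside its range have probability zero. -/
theorem entropy_signal_copy (hM : ∀ k, 0 < C.M k) (hJ : D.IsScaledCoupling 1 J) :
    entropy (D.seqMass C J) (fun z => ((fun t => (z.2.2 t).2), z.2.1)) =
      entropy (C.outMass W i) (fun z => (z.1 i, z.2)) := by
  classical
  have hMi : (C.M i : ℝ) ≠ 0 := by have := hM i; positivity
  have hP : ∀ s v, prob (D.seqMass C J) (fun z => ((fun t => (z.2.2 t).2), z.2.1) = (s, v)) =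
      (C.M i : ℝ)⁻¹ * ∑ w, (∏ j, (C.M j : ℝ))⁻¹ *
        ∏ t, D.law i (D.ref i (C.enc i v t)) (C.input t w) (s t) := by
    intro s v
    rw [prob_prod_type, Finset.mul_sum]
    refine Finset.sum_congr rfl fun w _ => ?_
    rw [prob_prod_type, Finset.sum_eq_single v]
    · simp only [Prod.mk.injEq, and_true, seqMass, prob_const_mul]
      rw [prob_prod (fun t => J (C.input t w) (D.ref i (C.enc i v t))) (fun _ z => z.2) s]
      simp only [hJ.prob_snd]
      ring
    · intro v' _ hne
      simp [prob, hne]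
    · simp
  have hQ : ∀ u v, prob (C.outMass W i) (fun z => (z.1 i, z.2) = (v, u)) =
      ∑ w, if w i = v then (∏ j, (C.M j : ℝ))⁻¹ * ∏ t, W.out i (C.input t w) (u t) else 0 := by
    intro u v
    rw [prob_prod_type]
    refine Finset.sum_congr rfl fun w _ => ?_
    by_cases hw : w i = v <;> simp [hw, prob, Code.outMass]
  rw [entropy, entropy, Fintype.sum_prod_type_right, Fintype.sum_prod_type]
  refine Finset.sum_congr rfl fun v _ => ?_
  refine Fintype.sum_of_injective (fun s t => D.combine i (C.enc i v t) (s t))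
    (fun s s' h => funext fun t => D.combine_injective i _ (congrFun h t)) _ _
    (fun u hu => ?_) fun s => ?_
  · rw [hQ, Finset.sum_eq_zero, Real.negMulLog_zero]
    intro w _
    split_ifs with hw
    · obtain ⟨t, ht⟩ : ∃ t, ∀ s, D.combine i (C.enc i v t) s ≠ u t := by
        by_contra! hcon
        choose s hs using hcon
        exact hu ⟨s, funext hs⟩
      rw [Finset.prod_eq_zero (Finset.mem_univ t), mul_zero]
      rw [D.out_eq]
      refine Finset.sum_eq_zero fun s _ => if_neg ?_
      have : C.input t w i = C.enc i v t := by rw [← hw]; rfl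
      rw [this]
      exact ht s
    · rfl
  · rw [hP, hQ]
    congr 1
    -- The factor `C.M i` gained by fixing message `i` to `v` cancels the probability of the copy.
    rw [sum_eq_card_mul_sum_ite (fun w => (∏ j, (C.M j : ℝ))⁻¹ *
      ∏ t, D.law i (D.ref i (C.enc i v t)) (C.input t w) (s t)) i _ v, Fintype.card_fin,
      inv_mul_cancel_left₀ hMi]
    · refine Finset.sum_congr rfl fun w _ => ?_
      split_ifs with hw
      · congr 1
        refine Finset.prod_congr rfl fun t _ => ?_
        subst hw
        exact (law_combine i (C.input t w) (s t)).symm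
      · rfl
    · intro w a
      congr 1
      refine Finset.prod_congr rfl fun t _ => ?_
      have : C.input t (Function.update w i a) =
          Function.update (C.input t w) i (C.enc i a t) := by
        ext j
        by_cases h : j = i
        · subst h; simp [Code.input]
        · simp [Code.input, h]
      rw [this, D.law_update]

/-- The gap between the output entropy at destination `k` and the equivocation at destination `i` is
at most the sum of the single-letter terms. -/
theorem entropy_sub_le_sum_term [∀ k, Fintype (A k)] (hM : ∀ k, 0 < C.M k)
    (hJ : D.IsScaledCoupling 1 J) :
    entropy (C.outMass W k) (fun z => z.2) -
      (entropy (C.outMass W i) (fun z => (z.1 i, z.2)) - Real.log (C.M i)) ≤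
      ∑ t, D.term (C.inputLaw t) J := by
  have h1 := condEntropy_output_le hM hJ
  have h2 := le_condEntropy_signal hM hJ
  rw [condEntropy_eq_sub (seqMass_nonneg hJ), entropy_signal_copy hM hJ] at h1
  rw [condEntropy_eq_sub (seqMass_nonneg hJ), entropy_output_copy hM hJ] at h2
  -- The joint entropy of output, signal and copy occurs in both bounds and cancels, and with it the
  -- dependence on the coupling.
  have h3 : entropy (D.seqMass C J) (fun z => ((fun t => (z.2.2 t).2),
      ((fun t => (z.2.2 t).1), z.2.1))) =
      entropy (D.seqMass C J)
        (fun z => ((fun t => (z.2.2 t).1), ((fun t => (z.2.2 t).2), z.2.1))) :=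
    entropy_comp_of_injective (D.seqMass C J)
      (fun z => ((fun t => (z.2.2 t).1), ((fun t => (z.2.2 t).2), z.2.1)))
      (f := fun b : (Fin n → Y k) × (Fin n → V i) × Fin (C.M i) => (b.2.1, (b.1, b.2.2)))
      (by rintro ⟨a, b, c⟩ ⟨a', b', c'⟩ h; simp_all)
  simp only [term, Finset.sum_sub_distrib]
  linarith

/-- The sum-rate bound for a single block code. -/
theorem one_sub_errorProb_mul_sum_log_le [∀ k, Fintype (A k)] (hM : ∀ k, 0 < C.M k)
    (π : Equiv.Perm (Fin 3)) (J : ∀ k, (∀ j, X j) → A (π k) → Y k × V (π k) → ℝ)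
    (hJ : ∀ k, D.IsScaledCoupling 1 (J k)) :
    (1 - W.errorProb C) * ∑ k, Real.log (C.M k) ≤
      ∑ t, ∑ k, D.term (C.inputLaw t) (J k) + 3 * Real.log 2 := by
  have h1 := Finset.sum_le_sum fun k (_ : k ∈ (Finset.univ : Finset (Fin 3))) =>
    Code.one_sub_errorProb_mul_log_le (W := W) hM k
  have h2 := Finset.sum_le_sum fun k (_ : k ∈ (Finset.univ : Finset (Fin 3))) =>
    entropy_sub_le_sum_term hM (hJ k)
  -- Reindexing by `π` matches each equivocation with the output entropy of its own destination, as
  -- in Fano's inequality.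
  rw [Finset.sum_sub_distrib, Equiv.sum_comp π fun i =>
    entropy (C.outMass W i) (fun z => (z.1 i, z.2)) - Real.log (C.M i), Finset.sum_comm] at h2
  rw [← Finset.mul_sum, Finset.sum_add_distrib, Finset.sum_sub_distrib] at h1
  simp only [Finset.sum_const, Finset.card_univ, Fintype.card_fin, nsmul_eq_mul,
    Nat.cast_ofNat] at h1
  linarith

end RefRemoval

/-- The laws are those of the codeword symbols at each time. They are chosen before the removal, the
permutation and the couplings, which gives the uniformity needed later. -/
theorem Channel.exists_inputLaws_of_achievable (W : Channel X Y) {R : Fin 3 → ℝ}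
    (hR : W.Achievable R) {ε : ℝ} (hε : 0 < ε) :
    ∃ (n : ℕ) (p : Fin n → RefRemoval.InputLaws X), 0 < n ∧
      ∀ (A V : Fin 3 → Type*) [∀ k, Fintype (A k)] [∀ k, Fintype (V k)] (D : RefRemoval W A V)
        (π : Equiv.Perm (Fin 3)) (J : ∀ k, (∀ j, X j) → A (π k) → Y k × V (π k) → ℝ),
        (∀ k, D.IsScaledCoupling 1 (J k)) →
          n * (∑ k, R k - ε) ≤ ∑ t, ∑ k, D.term (p t).1 (J k) := by
  obtain ⟨hR0, hR⟩ := hR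
  set ρ := ∑ k, R k with hρ
  have hρ0 : 0 ≤ ρ := Finset.sum_nonneg fun k _ => hR0 k
  -- The loss ε is split in halves: one for error probability times `ρ`, one for the Fano term 3 log
  -- 2 / n, whence the 6 in the next bound. The cap 1 keeps the factor 1 - error nonnegative, and `ρ
  -- + 1` avoids dividing by zero.
  obtain ⟨N, hN⟩ := hR (min 1 (ε / (2 * (ρ + 1)))) (by positivity)
  obtain ⟨n₀, hn₀⟩ := exists_nat_gt (6 * Real.log 2 / ε)
  set n := max (max N n₀) 1 with hn
  have hn1 : 0 < n := by omega
  obtain ⟨C, hCM, hCe⟩ := hN n (by omega)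
  have hM : ∀ k, 0 < C.M k := fun k => by
    have := (Real.exp_pos _).trans_le (hCM k)
    exact_mod_cast this
  refine ⟨n, fun t => ⟨C.inputLaw t, Code.inputLaw_mem hM t⟩, hn1, ?_⟩
  intro A V _ _ D π J hJ
  have hmain := RefRemoval.one_sub_errorProb_mul_sum_log_le hM π J hJ
  have he1 : W.errorProb C ≤ 1 := hCe.trans (min_le_left _ _)
  have he2 : W.errorProb C * ρ ≤ ε / 2 := by
    calc W.errorProb C * ρ ≤ ε / (2 * (ρ + 1)) * ρ :=
          mul_le_mul_of_nonneg_right (hCe.trans (min_le_right _ _)) hρ0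
      _ ≤ ε / (2 * (ρ + 1)) * (ρ + 1) := by gcongr; linarith
      _ = ε / 2 := by field_simp
  have hlog : n * ρ ≤ ∑ k, Real.log (C.M k) := by
    rw [hρ, Finset.mul_sum]
    exact Finset.sum_le_sum fun k _ => by
      rw [Real.le_log_iff_exp_le (by exact_mod_cast hM k)]; exact hCM k
  have hnn : 6 * Real.log 2 ≤ n * ε := by
    rw [← div_le_iff₀ hε]
    exact hn₀.le.trans (by exact_mod_cast (by omega : n₀ ≤ n))
  have h1 := mul_le_mul_of_nonneg_left hlog (sub_nonneg.2 he1)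
  have h2 := mul_le_mul_of_nonneg_left he2 (Nat.cast_nonneg (α := ℝ) n)
  nlinarith

/-- The sum rate of a point of the capacity region is approached by achievable rate triples. -/
theorem Channel.exists_achievable_of_mem_capacityRegion (W : Channel X Y) {R : Fin 3 → ℝ}
    (hR : R ∈ W.capacityRegion) {ε : ℝ} (hε : 0 < ε) :
    ∃ R', W.Achievable R' ∧ ∑ k, R k - ε ≤ ∑ k, R' k := by
  by_contra! hcon
  have hlin : IsLinearMap ℝ fun S : Fin 3 → ℝ => ∑ k, S k :=
    ⟨fun S T => by simp [Finset.sum_add_distrib], fun c S => by simp [Finset.mul_sum]⟩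
  have h := closure_minimal (convexHull_min (𝕜 := ℝ) (s := {R | W.Achievable R})
    (t := {S | ∑ k, S k ≤ ∑ k, R k - ε}) (fun S hS => (hcon S hS).le)
    (convex_halfSpace_le hlin _)) (isClosed_le (by fun_prop) (by fun_prop)) hR
  have h' : ∑ k, R k ≤ ∑ k, R k - ε := h
  linarith

theorem RefRemoval.exists_mixture_of_mem_capacityRegion {A V : Fin 3 → Type*}
    [∀ k, Fintype (A k)] [∀ k, Fintype (V k)] (D : RefRemoval W A V) {R : Fin 3 → ℝ}
    (hR : R ∈ W.capacityRegion) :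
    ∃ (m : ℕ) (P : InputDist X m), ∀ (π : Equiv.Perm (Fin 3))
      (J : ∀ k, (∀ j, X j) → A (π k) → Y k × V (π k) → ℝ), (∀ k, D.IsScaledCoupling 1 (J k)) →
        ∑ k, R k ≤ ∑ k, ∑ q, P.timeLaw q * D.term (fun j => P.inLaw j q) (J k) := by
  have key : ∀ ε > 0, ∃ (n : ℕ) (p : Fin n → InputLaws X), 0 < n ∧
      ∀ (π : Equiv.Perm (Fin 3)) (J : ∀ k, (∀ j, X j) → A (π k) → Y k × V (π k) → ℝ),
        (∀ k, D.IsScaledCoupling 1 (J k)) →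
          n * (∑ k, R k - ε) ≤ ∑ t, ∑ k, D.term (p t).1 (J k) := by
    intro ε hε
    obtain ⟨R', hR', hle⟩ := W.exists_achievable_of_mem_capacityRegion hR (half_pos hε)
    obtain ⟨n, p, hn, hp⟩ := W.exists_inputLaws_of_achievable hR' (half_pos hε)
    refine ⟨n, p, hn, fun π J hJ => le_trans ?_ (hp A V D π J hJ)⟩
    exact mul_le_mul_of_nonneg_left (by linarith) (Nat.cast_nonneg _)
  -- Input alphabets are not assumed nonempty; the laws of an actual code supply a point.
  have : Nonempty (InputLaws X) := by
    obtain ⟨n, p, hn, _⟩ := key 1 one_pos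
    exact ⟨p ⟨0, hn⟩⟩
  obtain ⟨m, p, l, hl, h⟩ := D.exists_finite_mixture_of_forall key
  refine ⟨m, ⟨l, hl, fun j q => (p q).1 j, fun j q => (p q).2 j⟩, fun π J hJ => ?_⟩
  rw [Finset.sum_comm]
  simp only [← Finset.mul_sum]
  exact h π J hJ

end Converse

/-! ### The two kinds of removal as instances. -/

section Instances

variable {X Y : Fin 3 → Type*} [∀ k, Fintype (X k)] [∀ k, Fintype (Y k)]

/-- Removal with the replaced input itself as reference. -/
noncomputable def Channel.replacement (W : Channel X Y) : RefRemoval W X Y where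
  ref _ x := x
  law i r x := W.removed i r x
  law_mem i r x := ⟨fun y => W.out_nonneg i _ y, W.sum_out i _⟩
  law_update i a x r := by simp [Channel.removed]
  combine _ _ v := v
  combine_injective _ _ := Function.injective_id
  out_eq i x y := by
    classical
    simp [Channel.removed, prob]

/-- Outright removal, without a reference. -/
noncomputable def Removal.toRefRemoval {W : Channel X Y} {V : Fin 3 → Type*} [∀ k, Fintype (V k)]
    (D : Removal W V) : RefRemoval W (fun _ => Unit) V where
  ref _ _ := ()
  law i _ x := D.law i x
  law_mem i _ x := D.law_mem i x
  law_update i _ x r := D.law_update i x r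
  combine := D.combine
  combine_injective := D.combine_injective
  out_eq i x y := D.out_eq i x y

theorem RefRemoval.term_timeSharing {W : Channel X Y} {A V : Fin 3 → Type*} [∀ k, Fintype (A k)]
    [∀ k, Fintype (V k)] (D : RefRemoval W A V) {m : ℕ} (P : InputDist X m) {k i : Fin 3}
    {J : (∀ j, X j) → A i → Y k × V i → ℝ} (hJ : D.IsScaledCoupling 1 J)
    {p : Fin m × (∀ j, X j) × A i × Y k × V i → ℝ}
    (hp : p = fun z => P.timeLaw z.1 * D.mass (fun j => P.inLaw j z.1) J z.2) :
    condEntropy p (fun z => z.2.2.2.1) (fun z => (z.2.2.2.2, z.2.2.1, z.1)) -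
      condEntropy p (fun z => z.2.2.2.2) (fun z => (z.2.2.2.1, z.2.1, z.2.2.1, z.1)) =
      ∑ q, P.timeLaw q * D.term (fun j => P.inLaw j q) J := by
  have hp0 : ∀ z, 0 ≤ p z := fun z => by
    rw [hp]
    exact mul_nonneg (P.timeLaw_mem.1 _) (D.mass_nonneg (fun j => P.inLaw_mem j z.1) hJ.nonneg _)
  have h1 := condEntropy_comp_of_injective hp0 (fun z => z.2.2.2.1)
    (fun z => ((z.2.2.2.2, z.2.2.1), z.1))
    (f := fun b : (V i × A i) × Fin m => (b.1.1, b.1.2, b.2))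
    (by rintro ⟨⟨a, b⟩, c⟩ ⟨⟨a', b'⟩, c'⟩ h; simp_all)
  have h2 := condEntropy_comp_of_injective hp0 (fun z => z.2.2.2.2)
    (fun z => ((z.2.2.2.1, z.2.1, z.2.2.1), z.1))
    (f := fun b : (Y k × (∀ j, X j) × A i) × Fin m => (b.1.1, b.1.2.1, b.1.2.2, b.2))
    (by rintro ⟨⟨a, b, d⟩, c⟩ ⟨⟨a', b', d'⟩, c'⟩ h; simp_all)
  rw [h1, h2, hp]
  simp only [term, mul_sub, Finset.sum_sub_distrib]
  rw [← condEntropy_timeSharing, ← condEntropy_timeSharing]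

theorem refTerm_eq (W : Channel X Y) {m : ℕ} (P : InputDist X m) {k i : Fin 3}
    {J : (∀ j, X j) → X i → Y k × Y i → ℝ} (hJ : W.replacement.IsScaledCoupling 1 J) :
    refTerm P J = ∑ q, P.timeLaw q * W.replacement.term (fun j => P.inLaw j q) J := by
  rw [← W.replacement.term_timeSharing P hJ (p := refJoint P J)]
  · rfl
  · classical
    funext ⟨q, x, r, y, s⟩
    simp only [refJoint, InputDist.joint, RefRemoval.mass, RefRemoval.refLaw, Channel.replacement]
    simp [prob, mul_assoc]

/-- A reference in `Unit` has mass one and carries no information, so it can be inserted into the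
sample space and the conditions. -/
theorem sideTerm_eq {W : Channel X Y} {V : Fin 3 → Type*} [∀ k, Fintype (V k)] (D : Removal W V)
    {m : ℕ} (P : InputDist X m) {k i : Fin 3} {J : (∀ j, X j) → Y k × V i → ℝ}
    (hJ : D.toRefRemoval.IsScaledCoupling 1 (fun x (_ : Unit) => J x)) :
    sideTerm P J = ∑ q, P.timeLaw q *
      D.toRefRemoval.term (fun j => P.inLaw j q) (fun x (_ : Unit) => J x) := by
  let e : Fin m × (∀ j, X j) × Unit × Y k × V i ≃ Fin m × (∀ j, X j) × Y k × V i :=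
    ⟨fun z => (z.1, z.2.1, z.2.2.2), fun z => (z.1, z.2.1, (), z.2.2), fun _ => rfl, fun _ => rfl⟩
  let p : Fin m × (∀ j, X j) × Unit × Y k × V i → ℝ := fun z => sideJoint P J (e z)
  have hp : p = fun z => P.timeLaw z.1 * D.toRefRemoval.mass (fun j => P.inLaw j z.1)
      (fun x (_ : Unit) => J x) z.2 := by
    funext ⟨q, x, r, y, s⟩
    have h1 : D.toRefRemoval.refLaw (fun j => P.inLaw j q) i r = 1 := by
      have := D.toRefRemoval.sum_refLaw (i := i) (fun j => P.inLaw_mem j q)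
      simpa using this
    simp only [p, e, sideJoint, InputDist.joint, RefRemoval.mass, Equiv.coe_fn_mk, h1, mul_one,
      mul_assoc]
  have hp0 : ∀ z, 0 ≤ p z := fun z => by
    rw [hp]
    exact mul_nonneg (P.timeLaw_mem.1 _)
      (D.toRefRemoval.mass_nonneg (fun j => P.inLaw_mem j z.1) hJ.nonneg _)
  rw [← D.toRefRemoval.term_timeSharing P hJ hp]
  have h1 := condEntropy_comp_of_injective hp0 (fun z => z.2.2.2.1)
    (fun z => (z.2.2.2.2, z.1)) (f := fun b : V i × Fin m => (b.1, (), b.2))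
    (by rintro ⟨a, b⟩ ⟨a', b'⟩ h; simp_all)
  have h2 := condEntropy_comp_of_injective hp0 (fun z => z.2.2.2.2)
    (fun z => (z.2.2.2.1, z.2.1, z.1))
    (f := fun b : Y k × (∀ j, X j) × Fin m => (b.1, b.2.1, (), b.2.2))
    (by rintro ⟨a, b, c⟩ ⟨a', b', c'⟩ h; simp_all)
  have h3 := condEntropy_comp_equiv e (sideJoint P J) (fun z => z.2.2.1) (fun z => (z.2.2.2, z.1))
  have h4 := condEntropy_comp_equiv e (sideJoint P J) (fun z => z.2.2.2)
    (fun z => (z.2.2.1, z.2.1, z.1))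
  refine Eq.trans ?_ (congrArg₂ (· - ·) (h1.trans h3) (h2.trans h4)).symm
  rfl

end Instances

end IFC

theorem theorem2 {X Y : Fin 3 → Type*} [∀ k, Fintype (X k)] [∀ k, Fintype (Y k)]
    (W : IFC.Channel X Y) (R : Fin 3 → ℝ) (hR : R ∈ W.capacityRegion) :
    (∃ (m : ℕ) (P : IFC.InputDist X m), ∀ (π : Equiv.Perm (Fin 3))
      (J : ∀ k, (∀ j, X j) → X (π k) → Y k × Y (π k) → ℝ),
      (∀ k x r, IFC.IsCoupling (W.out k x) (W.removed (π k) r x) (J k x r)) →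
        R 0 + R 1 + R 2 ≤ ∑ k, IFC.refTerm P (J k)) ∧
    (∀ (V : Fin 3 → Type*) [∀ k, Fintype (V k)] (D : IFC.Removal W V),
      ∃ (m : ℕ) (P : IFC.InputDist X m), ∀ (π : Equiv.Perm (Fin 3))
        (J : ∀ k, (∀ j, X j) → Y k × V (π k) → ℝ),
        (∀ k x, IFC.IsCoupling (W.out k x) (D.law (π k) x) (J k x)) →
          R 0 + R 1 + R 2 ≤ ∑ k, IFC.sideTerm P (J k)) := by
  refine ⟨?_, fun V _ D => ?_⟩
  · obtain ⟨m, P, h⟩ := W.replacement.exists_mixture_of_mem_capacityRegion hR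
    refine ⟨m, P, fun π J hJ => ?_⟩
    have hJ' : ∀ k, W.replacement.IsScaledCoupling 1 (J k) := fun k =>
      ⟨fun x r => (hJ k x r).nonneg, fun x r y => by rw [one_mul]; exact (hJ k x r).fst y,
        fun x r y => by rw [one_mul]; exact (hJ k x r).snd y⟩
    have := h π J hJ'
    rw [Fin.sum_univ_three] at this
    simpa only [IFC.refTerm_eq W P (hJ' _)] using this
  · obtain ⟨m, P, h⟩ := D.toRefRemoval.exists_mixture_of_mem_capacityRegion hR
    refine ⟨m, P, fun π J hJ => ?_⟩
    have hJ' : ∀ k, D.toRefRemoval.IsScaledCoupling 1 (fun x (_ : Unit) => J k x) := fun k =>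
      ⟨fun x _ => (hJ k x).nonneg, fun x _ y => by rw [one_mul]; exact (hJ k x).fst y,
        fun x _ y => by rw [one_mul]; exact (hJ k x).snd y⟩
    have := h π (fun k x _ => J k x) hJ'
    rw [Fin.sum_univ_three] at this
    simpa only [IFC.sideTerm_eq D P (hJ' _)] using this
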